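/- **Conventions.** For a number field $K$, a finite set $S$ of places of $K$ is always assumed to contain the archimedean places, and $\mathcal{O}_{K,S}$ is the ring of $S$-integers. Binary forms $F,G\in K[X,Z]$ of degree $r$ are equivalent if $G(X,Z)=\lambda F(aX+bZ,cX+dZ)$ for some $\begin{pmatrix}a&b\\c&d\end{pmatrix}\in \mathrm{GL}_2(K)$ and $\lambda\in K^*$; $[F]$ is the equivalence class of $F$. Let $\mathcal{B}'(r,K,S)$ be the set of equivalence classes of binary forms of degree $r$ over $K$ that have a representative $F\in\mathcal{O}_{K,S}[X,Z]$ with the following property: for every prime $\mathfrak{p}\notin S$ with $\mathrm{ord}_{\mathfrak p}\,\mathrm{disc}(F)>0$ there are a positive integer $m$ and an odd integer $n$ with $3\le n\le 2\lfloor (r+1)/2\rfloor-3$ such that $\mathrm{ord}_{\mathfrak p}\,\mathrm{disc}(F)=2mn(n-1)$ and $F(x,1)$ has $n$ distinct roots in $K$ whose order at $\mathfrak p$ is $2m$. (Here $\mathrm{ord}_{\mathfrak p}(0)=\infty$.) **Theorem.** Let $k$ be a number field, $g\ge 1$ an integer, $\alpha_1,\dots,\alpha_{2g+1}\in k$ distinct,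 and let $C$ be the nonsingular projective curve of genus $g$ over $k$ given by $y^2=\prod_{i=1}^{2g+1}(x-\alpha_i)$. Let $f\in k(C)$ be a nonconstant rational function, $S$ a finite set of places of $k$ containing the archimedean places, and $C(f,k,S)=\{P\in C(k)\mid f(P)\in\mathcal{O}_{k,S}\}$. Fix a pole $Q=(x_Q,y_Q)\in C(\bar k)$ of $f$ that is not the point at infinity, and let $U$ be the set consisting of the Weierstrass points of $C$ (the point at infinity and the points with $y=0$), $Q$, and the image $(x_Q,-y_Q)$ of $Q$ under the hyperelliptic involution. Then there exist a number field $L$ with $k\subset L\subset\bar k$ and a finite set $T$ of places of $L$ (containing the archimedean ones) such that for every $P=(x_P,y_P)\in C(f,k,S)\setminus U$: 1. there exist $\beta_1,\dots,\beta_{2g+1}\in\bar k$ with $\beta_i^2=\dfrac{x_Q-\alpha_i}{x_P-\alpha_i}$ for all $i$ and $\prod_{i=1}^{2g+1}\beta_i=\dfrac{y_Q}{y_P}$; 2. for every such choice, all $\beta_i$ lie in $L$ and $\Big[(X-Z)\prod_{i=1}^{2g+1}(X-\beta_iZ)\Big]\in\mathcal{B}'(2g+2,L,T)$. In particular, after any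 choice of such $\beta_i$ for each $P$, the rule $P\mapsto \big[(X-Z)\prod_{i=1}^{2g+1}(X-\beta_iZ)\big]$ defines a map $C(f,k,S)\setminus U\to\mathcal{B}'(2g+2,L,T)$. -/

import Mathlib

open Polynomial IsDedekindDomain NumberField

noncomputable section

namespace HyperellipticForms

/-! ### The affine curve `y² = h(x)`, its function field, and values of rational functions -/

/-- The coordinate ring `K[x, y] / (y² - h(x))`. -/
abbrev CoordRing {K : Type*} [Field K] (h : K[X]) : Type _ :=
  AdjoinRoot ((X : K[X][X]) ^ 2 - C h)

/-- The field `K(C)` of rational functions on `C : y² = h(x)`: the fractions of the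
coordinate ring. -/
abbrev RatFun {K : Type*} [Field K] (h : K[X]) : Type _ :=
  FractionRing (CoordRing h)

/-- Affine points of `y² = h(x)` with coordinates in an extension `Ω` of the base field. -/
@[ext]
structure AffinePoint {K : Type*} [Field K] (h : K[X]) (Ω : Type*) [Field Ω] [Algebra K Ω] where
  x : Ω
  y : Ω
  equation : y ^ 2 = aeval x h

namespace AffinePoint

variable {K : Type*} [Field K] {h : K[X]} {Ω : Type*} [Field Ω] [Algebra K Ω]

/-- The image `(x, -y)` of a point under the hyperelliptic involution. -/
def conj (P : AffinePoint h Ω) : AffinePoint h Ω :=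
  ⟨P.x, -P.y, by rw [neg_sq, P.equation]⟩

/-- A `K`-rational point seen as a point over an extension of `K`. -/
def baseChange (P : AffinePoint h K) (Ω : Type*) [Field Ω] [Algebra K Ω] : AffinePoint h Ω :=
  ⟨algebraMap K Ω P.x, algebraMap K Ω P.y, by
    rw [← map_pow, P.equation, aeval_algebraMap_apply]⟩

/-- Evaluation of polynomial functions in `x, y` at a point of the curve. -/
def evalAt (P : AffinePoint h Ω) : CoordRing h →+* Ω :=
  AdjoinRoot.lift ((aeval P.x : K[X] →ₐ[K] Ω) : K[X] →+* Ω) P.y (by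
    simp [P.equation])

/-- `f` lies in the local ring of the curve at `P` and takes the value `c` at `P`: it can be
written as `a / b` with polynomial functions `a, b`, `b(P) ≠ 0`, and `a(P) / b(P) = c`. -/
def HasValueAt (f : RatFun h) (P : AffinePoint h Ω) (c : Ω) : Prop :=
  ∃ a b : CoordRing h, P.evalAt b ≠ 0 ∧
    algebraMap (CoordRing h) (RatFun h) b * f = algebraMap (CoordRing h) (RatFun h) a ∧
    P.evalAt a / P.evalAt b = c

/-- `P` is a pole of `f`, i.e. `f` is not in the local ring at `P`
(on a nonsingular curve this says that `f` has negative order at `P`). -/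
def IsPole (f : RatFun h) (P : AffinePoint h Ω) : Prop :=
  ¬ ∃ c : Ω, HasValueAt f P c

end AffinePoint

/-- The affine points of `C(f, K, S) = {P ∈ C(K) : f(P) ∈ O_{K,S}}`. The set `S` of places is
given by its nonarchimedean members (all archimedean places are always included). -/
def integralPoints {K : Type*} [Field K] [NumberField K] {h : K[X]} (f : RatFun h)
    (S : Finset (HeightOneSpectrum (𝓞 K))) : Set (AffinePoint h K) :=
  {P | ∃ c ∈ (S : Set (HeightOneSpectrum (𝓞 K))).integer K, P.HasValueAt f c}

/-- The affine part of the exceptional set: the points with `y = 0` (with the point at infinity,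
these are the Weierstrass points when `h` has odd degree), and `Q` with its conjugate. -/
def exceptionalSet {K : Type*} [Field K] {h : K[X]} {Ω : Type*} [Field Ω] [Algebra K Ω]
    (Q : AffinePoint h Ω) : Set (AffinePoint h Ω) :=
  {R | R.y = 0} ∪ {Q, Q.conj}

/-- `h(x) = ∏ (x - αᵢ)`. -/
def rootPoly {K : Type*} [Field K] {n : ℕ} (α : Fin n → K) : K[X] :=
  ∏ i, (X - C (α i))

/-- `β` satisfies `βᵢ² = (x_Q - αᵢ) / (x_P - αᵢ)` for all `i` and `∏ βᵢ = y_Q / y_P`. -/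
def IsSqrtChoice {K : Type*} [Field K] {n : ℕ} (α : Fin n → K) {Ω : Type*} [Field Ω] [Algebra K Ω]
    (P Q : AffinePoint (rootPoly α) Ω) (β : Fin n → Ω) : Prop :=
  (∀ i, β i ^ 2 = (Q.x - algebraMap K Ω (α i)) / (P.x - algebraMap K Ω (α i))) ∧
    ∏ i, β i = Q.y / P.y

/-! ### Binary forms -/

/-- Binary forms of degree `r` over `K`; the variables `X, Z` are `X 0, X 1`. -/
def BinaryForm (K : Type*) [Field K] (r : ℕ) : Type _ :=
  {F : MvPolynomial (Fin 2) K // F.IsHomogeneous r}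

namespace BinaryForm

variable {K : Type*} [Field K] {r : ℕ}

/-- `F_U(X, Z) = F(aX + bZ, cX + dZ)` for `U = (a, b; c, d)`, on polynomials. -/
def substPoly (U : Matrix (Fin 2) (Fin 2) K) :
    MvPolynomial (Fin 2) K →ₐ[K] MvPolynomial (Fin 2) K :=
  MvPolynomial.aeval fun i =>
    MvPolynomial.C (U i 0) * MvPolynomial.X 0 + MvPolynomial.C (U i 1) * MvPolynomial.X 1

theorem substPoly_one (F : MvPolynomial (Fin 2) K) : substPoly 1 F = F := by
  have : substPoly (1 : Matrix (Fin 2) (Fin 2) K) = AlgHom.id K _ := by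
    apply MvPolynomial.algHom_ext
    intro i
    fin_cases i <;> simp [substPoly]
  rw [this]; rfl

theorem substPoly_mul (U V : Matrix (Fin 2) (Fin 2) K) (F : MvPolynomial (Fin 2) K) :
    substPoly V (substPoly U F) = substPoly (U * V) F := by
  have : (substPoly V).comp (substPoly U) = substPoly (U * V) := by
    apply MvPolynomial.algHom_ext
    intro i
    simp only [substPoly, AlgHom.comp_apply, MvPolynomial.aeval_X, map_add, map_mul,
      MvPolynomial.algHom_C, MvPolynomial.algebraMap_eq, Matrix.mul_apply, Fin.sum_univ_two]
    ring
  exact DFunLike.congr_fun this F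

/-- Two binary forms are equivalent if `G = λ F_U` with `U ∈ GL₂(K)` and `λ ∈ Kˣ`. -/
def Equivalent (F G : BinaryForm K r) : Prop :=
  ∃ (U : GL (Fin 2) K) (c : Kˣ),
    G.1 = MvPolynomial.C (c : K) * substPoly (U : Matrix (Fin 2) (Fin 2) K) F.1

theorem equivalent_equivalence : Equivalence (Equivalent (K := K) (r := r)) where
  refl F := ⟨1, 1, by simp [substPoly_one]⟩
  symm := by
    rintro F G ⟨U, c, hG⟩
    refine ⟨U⁻¹, c⁻¹, ?_⟩
    rw [hG, map_mul, substPoly_mul, ← Units.val_mul, mul_inv_cancel, Units.val_one,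
      substPoly_one, MvPolynomial.algHom_C, MvPolynomial.algebraMap_eq, ← mul_assoc,
      ← MvPolynomial.C_mul, ← Units.val_mul, inv_mul_cancel]
    simp
  trans := by
    rintro F G H ⟨U, c, hG⟩ ⟨V, d, hH⟩
    refine ⟨U * V, d * c, ?_⟩
    rw [hH, hG, map_mul, substPoly_mul, MvPolynomial.algHom_C, MvPolynomial.algebraMap_eq,
      ← mul_assoc, ← MvPolynomial.C_mul, Units.val_mul, Units.val_mul]

/-- Equivalence of binary forms as a setoid. -/
def equivSetoid (K : Type*) [Field K] (r : ℕ) : Setoid (BinaryForm K r) :=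
  ⟨Equivalent, equivalent_equivalence⟩

/-- The set of equivalence classes of binary forms of degree `r` over `K`. -/
abbrev Classes (K : Type*) [Field K] (r : ℕ) : Type _ :=
  Quotient (equivSetoid K r)

/-- The class `[F]`. -/
def cls (F : BinaryForm K r) : Classes K r :=
  Quotient.mk (equivSetoid K r) F

/-- `f(x) = F(x, 1)`. -/
def dehomog (F : BinaryForm K r) : K[X] :=
  MvPolynomial.aeval ![(X : K[X]), 1] F.1

/-- The discriminant of a binary form of degree `r`, that is `∏_{i<j} (aᵢ bⱼ - aⱼ bᵢ)²` if
`F = ∏ (aᵢ X - bᵢ Z)`. In terms of `f = F(x, 1)` it is the discriminant of `f` if `deg f = r`;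
it is `lc(f)² disc(f)` if `deg f = r - 1` (when `Z` divides `F` once); and it is `0` if
`Z²` divides `F`. It is `1` (an empty product) if `r ≤ 1`. -/
def disc (F : BinaryForm K r) : K :=
  if r ≤ 1 then 1
  else if F.dehomog.natDegree = r then F.dehomog.discr
  else if F.dehomog.natDegree + 1 = r then F.dehomog.leadingCoeff ^ 2 * F.dehomog.discr
  else 0

/-- `F` has coefficients in the ring `O_{K,S}` of `S`-integers. -/
def IsSIntegral [NumberField K] (S : Finset (HeightOneSpectrum (𝓞 K)))
    (F : BinaryForm K r) : Prop :=
  ∀ d, F.1.coeff d ∈ (S : Set (HeightOneSpectrum (𝓞 K))).integer K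

/-- The condition at a prime `𝔭`: if `ord_𝔭 disc(F) > 0`, then `ord_𝔭 disc(F) = 2mn(n-1)` with
`m ≥ 1` and `n` odd, `3 ≤ n ≤ 2⌊(r+1)/2⌋ - 3`, and `F(x, 1)` has `n` roots in `K` of
order `2m` at `𝔭`. (`ord_𝔭 a = e` reads `v_𝔭(a) = exp(-e)`; `ord_𝔭 0 = ∞`, i.e. `v_𝔭(0) = 0`.) -/
def GoodAt [NumberField K] (p : HeightOneSpectrum (𝓞 K)) (F : BinaryForm K r) : Prop :=
  p.valuation K F.disc < 1 →
    ∃ m n : ℕ, 0 < m ∧ Odd n ∧ 3 ≤ n ∧ n + 3 ≤ 2 * ((r + 1) / 2) ∧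
      p.valuation K F.disc = WithZero.exp (-(2 * m * n * (n - 1) : ℤ)) ∧
      ∃ s : Finset K, s.card = n ∧
        ∀ a ∈ s, F.dehomog.IsRoot a ∧ p.valuation K a = WithZero.exp (-(2 * m : ℤ))

/-- The set `B'(r, K, S)` of classes that have a representative with `S`-integral coefficients
which satisfies `GoodAt` at all primes outside `S`. -/
def BPrime (r : ℕ) (K : Type*) [Field K] [NumberField K]
    (S : Finset (HeightOneSpectrum (𝓞 K))) : Set (Classes K r) :=
  {c | ∃ F : BinaryForm K r, F.cls = c ∧ F.IsSIntegral S ∧ ∀ p ∉ S, F.GoodAt p}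

/-- The binary form `(X - Z) ∏ (X - βᵢ Z)`. -/
def ofRoots {n : ℕ} (β : Fin n → K) : BinaryForm K (n + 1) :=
  ⟨(MvPolynomial.X 0 - MvPolynomial.X 1) *
      ∏ i, (MvPolynomial.X 0 - MvPolynomial.C (β i) * MvPolynomial.X 1), by
    rw [add_comm]
    refine ((MvPolynomial.isHomogeneous_X _ _).sub (MvPolynomial.isHomogeneous_X _ _)).mul ?_
    have := MvPolynomial.IsHomogeneous.prod (Finset.univ : Finset (Fin n))
      (fun i => (MvPolynomial.X 0 - MvPolynomial.C (β i) * MvPolynomial.X 1 :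
        MvPolynomial (Fin 2) K)) (fun _ => 1) (fun i _ =>
          (MvPolynomial.isHomogeneous_X _ _).sub (by
            simpa using (MvPolynomial.isHomogeneous_C (Fin 2) (β i)).mul
              (MvPolynomial.isHomogeneous_X K (1 : Fin 2))))
    simpa using this⟩

end BinaryForm

end HyperellipticForms

end

/-!
# Integral points on hyperelliptic curves and binary forms

Let `P` be a point with `f(P)` integral outside `S`. As `f` has a pole at `Q`, the inverse of `f` is
regular and vanishes at `Q` (`AffinePoint.IsPole.exists_mul_eq`, because the local ring of the
nonsingular curve at `Q` is a valuation ring). Hence, outside a finite set of primes, `P` does not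
reduce to `Q` (`exists_finset_not_congr_pole`); it may reduce to the conjugate `(x_Q, -y_Q)`.

The field `L`. Outside a finite set of primes the valuations of `x_P - αᵢ` are even, since the
product of these nearly coprime factors is the square `y_P²`. Finiteness of the class group and
finite generation of the units then leave finitely many classes of `x_P - αᵢ` modulo squares
(`exists_finset_eq_mul_sq`), so a single number field `L` contains all the `βᵢ`.

The form. Put `γ₀ = 1` and `γᵢ = βᵢ`. From `βᵢ² - 1 = (x_Q - x_P) / (x_P - αᵢ)` and the similar
formula for `βᵢ² - βⱼ²` one reads off the `𝔭`-adic distances of the `γⱼ`.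
* If `P` reduces to infinity, the `βᵢ` form one cluster near `0`.
* If `P` reduces to the conjugate of `Q`, every `βᵢ` is close to `1` or to `-1` at distance
  `ε = |x_Q - x_P|`, and since `∏ βᵢ = y_Q / y_P` is close to `-1` an odd number `n` of them is
  close to `-1`.
* Otherwise the `γⱼ` have distinct reductions in the projective line.

All primes are treated at once by the substitution `γ ↦ τ (c - γ) / (c + 2 - γ)`, of determinant
`-2τ`, where `c` is an integer close to `0` at the primes of the first kind and to `-1` at those of
the second kind, and `τ` has prescribed valuations, possible outside a finite set of primes by
finiteness of the class group (`exists_valuation_eq`, which also makes the linear factors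
primitive). The discriminant, a product of the determinants of pairs of linear factors
(`BinaryForm.disc_ofLinearFactors`), becomes a unit, except at primes of the second kind with
`n < 2g + 1`. There `|τ| = ε` sends the cluster at `-1` to `n` roots of absolute value `ε²` at
mutual distances `ε²`, while all other determinants are units: the discriminant has absolute value
`ε ^ (2n(n-1))`, which is the condition defining `B'`. The local computations are
`unitDeterminants_of_one_lt`, `unitDeterminants_of_valuation_sub_eq_one`, `exists_twoClusters` and
the lemmas on `TwoClusters`; they are combined in `cls_ofRoots_mem_BPrime`.
-/

noncomputable section

namespace HyperellipticForms

/-! ### Number fields: prescribed valuations and classes modulo squares -/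

section NumberFieldLemmas

variable {K : Type*} [Field K] [NumberField K]

theorem finite_setOf_valuation_ne_one {w : K} (hw : w ≠ 0) :
    {p : HeightOneSpectrum (𝓞 K) | p.valuation K w ≠ 1}.Finite := by
  refine ((HeightOneSpectrum.Support.finite (𝓞 K) w).union
    (HeightOneSpectrum.Support.finite (𝓞 K) w⁻¹)).subset fun p hp => ?_
  rcases lt_or_gt_of_ne hp with h | h
  · right
    have h0 : 0 < p.valuation K w := zero_lt_iff.mpr ((Valuation.ne_zero_iff _).mpr hw)
    change 1 < p.valuation K w⁻¹
    rw [map_inv₀]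
    exact (one_lt_inv₀ h0).mpr h
  · left; exact h

theorem exists_finset_valuation_eq_one (W : Finset K) :
    ∃ T : Finset (HeightOneSpectrum (𝓞 K)), ∀ p ∉ T, ∀ w ∈ W, w ≠ 0 → p.valuation K w = 1 := by
  classical
  have hfin : (⋃ w ∈ {w ∈ W | w ≠ 0},
      {p : HeightOneSpectrum (𝓞 K) | p.valuation K w ≠ 1}).Finite :=
    Set.Finite.biUnion (Finset.finite_toSet _) fun w hw =>
      finite_setOf_valuation_ne_one (Finset.mem_filter.mp hw).2
  refine ⟨hfin.toFinset, fun p hp w hw hw0 => ?_⟩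
  by_contra h
  exact hp (hfin.mem_toFinset.mpr (Set.mem_biUnion (Finset.mem_filter.mpr ⟨hw, hw0⟩) h))

/-- A generator of `P Q⁻¹` is a uniformizer at `P` and a unit elsewhere, away from `Q`. -/
theorem valuation_div_of_span_mul_eq (P Q p : HeightOneSpectrum (𝓞 K)) (hp : p ≠ Q) {x y : 𝓞 K}
    (hx : x ≠ 0) (hy : y ≠ 0)
    (h : Ideal.span {x} * P.asIdeal = Ideal.span {y} * Q.asIdeal) [Decidable (p = P)] :
    p.valuation K (algebraMap (𝓞 K) K y / algebraMap (𝓞 K) K x) =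
      if p = P then WithZero.exp (-1 : ℤ) else 1 := by
  classical
  have key : ∀ (z : 𝓞 K) (R : HeightOneSpectrum (𝓞 K)), z ≠ 0 →
      (Associates.mk p.asIdeal).count (Associates.mk (Ideal.span {z} * R.asIdeal)).factors =
      (Associates.mk p.asIdeal).count (Associates.mk (Ideal.span {z})).factors +
        if p = R then 1 else 0 := by
    intro z R hz
    rw [← Associates.mk_mul_mk, Associates.count_mul _ _ p.associates_irreducible]
    · congr 1
      split_ifs with hpR
      · subst hpR
        exact Associates.count_self p.associates_irreducible
      · refine Associates.count_eq_zero_of_ne p.associates_irreducible R.associates_irreducible ?_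
        intro hh
        apply hpR
        rw [Associates.mk_eq_mk_iff_associated, associated_iff_eq] at hh
        exact HeightOneSpectrum.ext hh
    · simpa using hz
    · simpa using R.ne_bot
  have h1 := key x P hx
  have h2 := key y Q hy
  rw [h, h2, if_neg hp] at h1
  rw [map_div₀, HeightOneSpectrum.valuation_of_algebraMap,
    HeightOneSpectrum.valuation_of_algebraMap, HeightOneSpectrum.intValuation_if_neg _ hx,
    HeightOneSpectrum.intValuation_if_neg _ hy, ← WithZero.exp_sub]
  simp only [add_zero] at h1
  rw [h1]
  split_ifs <;> simp

/-- Outside a fixed finite set of primes, there are elements with prescribed valuations, by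
finiteness of the class group. The values are prescribed at the primes in `A`, as those of `z p`. -/
theorem exists_valuation_eq (K : Type*) [Field K] [NumberField K] :
    ∃ T : Finset (HeightOneSpectrum (𝓞 K)), ∀ (A : Finset (HeightOneSpectrum (𝓞 K)))
      (z : HeightOneSpectrum (𝓞 K) → K), (∀ p ∈ A, z p ≠ 0) →
      ∃ t : K, t ≠ 0 ∧ (∀ p ∉ T, p ∈ A → p.valuation K t = p.valuation K (z p)) ∧
        ∀ p ∉ T, p ∉ A → p.valuation K t = 1 := by
  classical
  let cl : HeightOneSpectrum (𝓞 K) → ClassGroup (𝓞 K) := fun p =>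
    ClassGroup.mk0 ⟨p.asIdeal, mem_nonZeroDivisors_of_ne_zero p.ne_bot⟩
  have hfin : (Set.range cl).Finite := Set.toFinite _
  -- `q` picks a prime in every ideal class that contains one
  choose q hq using fun c : Set.range cl => c.2
  have hT : (Set.range q).Finite := Set.finite_range q
  -- every prime is principal up to one of these
  have key : ∀ p : HeightOneSpectrum (𝓞 K), ∃ t : K, t ≠ 0 ∧ ∀ l ∉ hT.toFinset,
      l.valuation K t = if l = p then WithZero.exp (-1 : ℤ) else 1 := by
    intro p
    have h := hq ⟨cl p, p, rfl⟩
    obtain ⟨x, y, hx, hy, hxy⟩ := ClassGroup.mk0_eq_mk0_iff.mp h.symm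
    refine ⟨algebraMap (𝓞 K) K y / algebraMap (𝓞 K) K x, by
      simp [hx, hy], fun l hl => ?_⟩
    refine valuation_div_of_span_mul_eq p _ l ?_ hx hy hxy
    rintro rfl
    exact hl (hT.mem_toFinset.mpr ⟨_, rfl⟩)
  choose t ht0 ht using key
  refine ⟨hT.toFinset, fun A z hz => ?_⟩
  let n : HeightOneSpectrum (𝓞 K) → ℤ := fun p => -WithZero.log (p.valuation K (z p))
  have hval : ∀ l ∉ hT.toFinset, l.valuation K (∏ p ∈ A, t p ^ n p) =
      ∏ p ∈ A, if l = p then WithZero.exp (-(n p)) else 1 := by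
    intro l hl
    rw [map_prod]
    refine Finset.prod_congr rfl fun p _ => ?_
    rw [map_zpow₀, ht p l hl]
    split_ifs
    · rw [← WithZero.exp_zsmul]; simp
    · simp
  refine ⟨∏ p ∈ A, t p ^ n p, Finset.prod_ne_zero_iff.mpr fun p _ => zpow_ne_zero _ (ht0 p),
    fun l hl hlA => ?_, fun l hl hlA => ?_⟩
  · rw [hval l hl, Finset.prod_ite_eq, if_pos hlA]
    simp only [n, neg_neg]
    exact WithZero.exp_log ((Valuation.ne_zero_iff _).mpr (hz l hlA))
  · rw [hval l hl, Finset.prod_ite_eq, if_neg hlA]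

/-- Simultaneous approximation by integers, avoiding finitely many values. -/
theorem exists_integer_valuation_sub_lt (A : Finset (HeightOneSpectrum (𝓞 K)))
    (x : HeightOneSpectrum (𝓞 K) → 𝓞 K) (z : HeightOneSpectrum (𝓞 K) → K)
    (hz : ∀ p ∈ A, z p ≠ 0) (F : Finset K) :
    ∃ c : 𝓞 K, algebraMap (𝓞 K) K c ∉ F ∧
      ∀ p ∈ A, p.valuation K (algebraMap (𝓞 K) K c - algebraMap (𝓞 K) K (x p)) <
        p.valuation K (z p) := by
  classical
  have hn : ∀ p : HeightOneSpectrum (𝓞 K), ∃ n : ℕ, p ∈ A →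
      WithZero.exp (-(n : ℤ)) < p.valuation K (z p) := by
    intro p
    refine ⟨(1 - WithZero.log (p.valuation K (z p))).toNat, fun hp => ?_⟩
    rw [← WithZero.exp_log ((Valuation.ne_zero_iff (p.valuation K)).mpr (hz p hp)),
      WithZero.exp_lt_exp]
    simp only [WithZero.log_exp]
    have := Int.self_le_toNat (1 - WithZero.log (p.valuation K (z p)))
    omega
  choose n hn using hn
  obtain ⟨y, hy⟩ := IsDedekindDomain.exists_forall_sub_mem_ideal (s := A) (fun p => p.asIdeal) n
    (fun p _ => p.prime) (fun p _ q _ hpq h => hpq (HeightOneSpectrum.ext h)) (fun p => x p)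
  obtain ⟨d, hd, hd0⟩ : ∃ d ∈ ∏ p ∈ A, p.asIdeal ^ n p, d ≠ 0 := by
    refine Submodule.exists_mem_ne_zero_of_ne_bot ?_
    exact Finset.prod_ne_zero_iff.mpr fun p _ => pow_ne_zero _ p.ne_bot
  obtain ⟨m, hm⟩ : ∃ m : ℕ, algebraMap (𝓞 K) K (y + m * d) ∉ F := by
    have hinj : Function.Injective fun m : ℕ => algebraMap (𝓞 K) K (y + m * d) := by
      intro a b hab
      have := FaithfulSMul.algebraMap_injective (𝓞 K) K hab
      have := mul_right_cancel₀ hd0 (add_left_cancel this)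
      exact_mod_cast this
    obtain ⟨v, ⟨m, rfl⟩, hv⟩ := (Set.infinite_range_of_injective hinj).exists_notMem_finset F
    exact ⟨m, hv⟩
  refine ⟨y + m * d, hm, fun p hp => lt_of_le_of_lt ?_ (hn p hp)⟩
  rw [← map_sub, HeightOneSpectrum.valuation_of_algebraMap,
    HeightOneSpectrum.intValuation_le_pow_iff_mem]
  have h1 := hy p hp
  have h2 : d ∈ p.asIdeal ^ n p := Ideal.le_of_dvd (Finset.dvd_prod_of_mem _ hp) hd
  have : y + m * d - x p = (y - x p) + m * d := by ring
  rw [this]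
  exact Ideal.add_mem _ h1 (Ideal.mul_mem_left _ _ h2)

/-- The group of `S`-units is finitely generated: the valuations in `S` map it to `ℤ^S`, and the
kernel is the group of units of the ring of integers. -/
theorem group_fg_unit (S : Finset (HeightOneSpectrum (𝓞 K))) :
    Group.FG ((S : Set (HeightOneSpectrum (𝓞 K))).unit K) := by
  let G := (S : Set (HeightOneSpectrum (𝓞 K))).unit K
  let φ : (𝓞 K)ˣ →* G :=
    (Units.map (algebraMap (𝓞 K) K : 𝓞 K →* K)).codRestrict G fun u p _ => by
      have h1 := p.valuation_le_one (K := K) (u : 𝓞 K)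
      have h2 := p.valuation_le_one (K := K) ((u⁻¹ : (𝓞 K)ˣ) : 𝓞 K)
      have h3 : p.valuation K (algebraMap (𝓞 K) K u) *
          p.valuation K (algebraMap (𝓞 K) K ((u⁻¹ : (𝓞 K)ˣ) : 𝓞 K)) = 1 := by
        rw [← map_mul, ← map_mul, Units.mul_inv]; simp
      refine le_antisymm h1 ?_
      rw [← h3]
      exact mul_le_of_le_one_right' h2
  let f : Additive (𝓞 K)ˣ →ₗ[ℤ] Additive G := (MonoidHom.toAdditive φ).toIntLinearMap
  let g : Additive G →ₗ[ℤ] (S → ℤ) := (AddMonoidHom.mk'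
    (fun x p => WithZero.log (p.1.valuation K ((x.toMul : Kˣ) : K))) (by
      intro x y
      funext p
      simp [WithZero.log_mul])).toIntLinearMap
  have hfg : LinearMap.ker g ≤ LinearMap.range f := by
    intro x hx
    have hval : ∀ p : HeightOneSpectrum (𝓞 K),
        p.valuation K ((x.toMul : Kˣ) : K) = 1 := by
      intro p
      by_cases hp : p ∈ S
      · have h : WithZero.log (p.valuation K ((x.toMul : Kˣ) : K)) = 0 :=
          congrFun (LinearMap.mem_ker.mp hx) ⟨p, hp⟩
        rw [← WithZero.exp_log (x := p.valuation K ((x.toMul : Kˣ) : K)) (by simp), h,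
          WithZero.exp_zero]
      · exact x.toMul.2 p hp
    obtain ⟨a, ha⟩ := HeightOneSpectrum.mem_integers_of_valuation_le_one K
      ((x.toMul : Kˣ) : K) fun p => (hval p).le
    obtain ⟨b, hb⟩ := HeightOneSpectrum.mem_integers_of_valuation_le_one K
      (((x.toMul : Kˣ)⁻¹ : Kˣ) : K) fun p : HeightOneSpectrum (𝓞 K) => by
        have h := hval p
        rw [Units.val_inv_eq_inv_val, map_inv₀, h, inv_one]
    have hab : a * b = 1 := by
      apply FaithfulSMul.algebraMap_injective (𝓞 K) K
      rw [map_mul, ha, hb]; simp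
    refine ⟨Additive.ofMul (Units.mkOfMulEqOne a b hab), ?_⟩
    apply Additive.toMul.injective
    ext
    exact ha
  have h1 : Module.Finite ℤ (Additive (𝓞 K)ˣ) := 
    Module.Finite.iff_addGroup_fg.mpr
      (@AddGroup.fg_of_group_fg _ _ (Group.fg_iff_monoid_fg.mpr inferInstance))
  have h2 : (⊤ : Submodule ℤ (Additive G)).FG := by
    refine Submodule.fg_of_fg_map_of_fg_inf_ker g (IsNoetherian.noetherian _) ?_
    rw [top_inf_eq]
    have : IsNoetherian ℤ (LinearMap.range f) := inferInstance
    have h3 := isNoetherian_of_le hfg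
    exact (isNoetherian_submodule.mp h3) _ le_rfl
  have h4 : AddGroup.FG (Additive G) := Module.Finite.iff_addGroup_fg.mp ⟨h2⟩
  exact GroupFG.iff_add_fg.mpr h4

/-- Modulo squares there are finitely many `S`-units. -/
theorem exists_finset_unit_eq_mul_sq (S : Finset (HeightOneSpectrum (𝓞 K))) :
    ∃ E : Finset K, ∀ u : K, u ≠ 0 → (∀ p ∉ S, p.valuation K u = 1) →
      ∃ e ∈ E, ∃ t : K, u = e * t ^ 2 := by
  classical
  let G : Subgroup Kˣ := (S : Set (HeightOneSpectrum (𝓞 K))).unit K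
  have : Group.FG G := group_fg_unit S
  let H : Subgroup G := (powMonoidHom 2 : G →* G).range
  have hH : IsMulTorsion (G ⧸ H) := by
    intro c
    obtain ⟨w, rfl⟩ := QuotientGroup.mk_surjective c
    refine isOfFinOrder_iff_pow_eq_one.mpr ⟨2, two_pos, ?_⟩
    rw [← QuotientGroup.mk_pow, QuotientGroup.eq_one_iff]
    exact ⟨w, rfl⟩
  have : Group.FG (G ⧸ H) := inferInstance
  have : Finite (G ⧸ H) := CommGroup.finite_of_fg_isMulTorsion _ hH
  have : Fintype (G ⧸ H) := Fintype.ofFinite _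
  let r : G → K := fun w => ((w : Kˣ) : K)
  refine ⟨Finset.univ.image fun c : G ⧸ H => r c.out, fun u hu h => ?_⟩
  let w : G := ⟨Units.mk0 u hu, fun p hp => h p (by simpa using hp)⟩
  obtain ⟨⟨_, t, rfl⟩, ht⟩ := QuotientGroup.mk_out_eq_mul H w
  refine ⟨_, Finset.mem_image_of_mem _ (Finset.mem_univ (w : G ⧸ H)), r t⁻¹, ?_⟩
  rw [ht]
  simp [w, r]

/-- Elements whose valuations outside `S` are squares lie in finitely many classes modulo
squares. -/
theorem exists_finset_eq_mul_sq (S : Finset (HeightOneSpectrum (𝓞 K))) :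
    ∃ E : Finset K, ∀ u : K, u ≠ 0 →
      (∀ p ∉ S, ∃ z : K, p.valuation K u = p.valuation K z ^ 2) →
      ∃ e ∈ E, ∃ t : K, u = e * t ^ 2 := by
  classical
  obtain ⟨T, hT⟩ := exists_valuation_eq K
  obtain ⟨E, hE⟩ := exists_finset_unit_eq_mul_sq (S ∪ T)
  refine ⟨E, fun u hu h => ?_⟩
  have h' : ∀ p, ∃ z : K, p ∉ S → p.valuation K u = p.valuation K z ^ 2 := by
    intro p
    by_cases hp : p ∈ S
    · exact ⟨0, fun h => (h hp).elim⟩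
    · obtain ⟨z, hz⟩ := h p hp
      exact ⟨z, fun _ => hz⟩
  choose z hz using h'
  have hfin := finite_setOf_valuation_ne_one hu
  -- `t` has the valuations of a square root of `u`, so that `u / t ^ 2` is a unit
  obtain ⟨t, ht0, ht1, ht2⟩ := hT {p ∈ hfin.toFinset | p ∉ S} z (by
    intro p hp h0
    have := hz p (Finset.mem_filter.mp hp).2
    rw [h0] at this
    simp [hu] at this)
  obtain ⟨e, he, s, hs⟩ := hE (u / t ^ 2) (by positivity) (by
    intro p hp
    rw [Finset.mem_union, not_or] at hp
    rw [map_div₀, map_pow]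
    by_cases hpu : p.valuation K u = 1
    · rw [ht2 p hp.2 (by simp [hpu]), hpu]; simp
    · rw [ht1 p hp.2 (by simp [hpu, hp.1]), ← hz p hp.1]
      exact div_self ((Valuation.ne_zero_iff _).mpr hu))
  refine ⟨e, he, s * t, ?_⟩
  rw [mul_pow, ← mul_assoc, ← hs]
  field_simp

end NumberFieldLemmas

/-! ### The curve: local rings and reduction of points -/

section Curve

variable {K : Type*} [Field K] {h : K[X]}

theorem monic_X_sq_sub_C (h : K[X]) : ((X : K[X][X]) ^ 2 - C h).Monic :=
  monic_X_pow_sub_C h two_ne_zero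

theorem isDomain_coordRing (hodd : Odd h.natDegree) : IsDomain (CoordRing h) := by
  refine AdjoinRoot.isDomain_of_prime (UniqueFactorizationMonoid.irreducible_iff_prime.mp ?_)
  have hdeg : ((X : K[X][X]) ^ 2 - C h).natDegree = 2 := natDegree_X_pow_sub_C
  rw [(monic_X_sq_sub_C h).irreducible_iff_roots_eq_zero_of_degree_le_three hdeg.ge
    (by rw [hdeg]; norm_num)]
  refine Multiset.eq_zero_of_forall_notMem fun r hr => ?_
  have hr' : r ^ 2 = h := by
    have := (mem_roots'.mp hr).2
    simpa [IsRoot, sub_eq_zero] using this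
  rw [← hr', natDegree_pow] at hodd
  exact Nat.not_odd_iff_even.mpr (even_two_mul _) hodd

/-- Every polynomial function on the curve is `u(x) + v(x) y`. -/
theorem exists_eq_of_add_of_mul_root (a : CoordRing h) :
    ∃ u v : K[X], a = AdjoinRoot.of _ u + AdjoinRoot.of _ v * AdjoinRoot.root _ := by
  obtain ⟨p, rfl⟩ := AdjoinRoot.mk_surjective a
  have hm := monic_X_sq_sub_C h
  have hdeg : (p %ₘ ((X : K[X][X]) ^ 2 - C h)).natDegree ≤ 1 := by
    have := natDegree_modByMonic_lt p hm (by
      intro h1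
      have := congrArg natDegree h1
      rw [natDegree_X_pow_sub_C] at this
      simp at this)
    rw [natDegree_X_pow_sub_C] at this
    omega
  obtain ⟨v, u, huv⟩ := exists_eq_X_add_C_of_natDegree_le_one hdeg
  refine ⟨u, v, ?_⟩
  have h1 := congrArg (AdjoinRoot.mk ((X : K[X][X]) ^ 2 - C h)) (modByMonic_add_div p (X ^ 2 - C h))
  rw [map_add, map_mul, AdjoinRoot.mk_self, zero_mul, add_zero, huv] at h1
  rw [← h1]
  simp [add_comm]

theorem root_sq : (AdjoinRoot.root ((X : K[X][X]) ^ 2 - C h)) ^ 2 = AdjoinRoot.of _ h := by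
  have := AdjoinRoot.eval₂_root ((X : K[X][X]) ^ 2 - C h)
  simpa [sub_eq_zero] using this

namespace AffinePoint

variable {Ω : Type*} [Field Ω] [Algebra K Ω]

@[simp]
theorem evalAt_of (P : AffinePoint h Ω) (u : K[X]) :
    P.evalAt (AdjoinRoot.of _ u) = aeval P.x u := by
  simp [evalAt]

@[simp]
theorem evalAt_root (P : AffinePoint h Ω) : P.evalAt (AdjoinRoot.root _) = P.y := by
  simp [evalAt]

/-- The image of a point under a homomorphism of the fields of coordinates. -/
def map {Ω' : Type*} [Field Ω'] [Algebra K Ω'] (φ : Ω →ₐ[K] Ω') (P : AffinePoint h Ω) :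
    AffinePoint h Ω' :=
  ⟨φ P.x, φ P.y, by rw [← map_pow, P.equation, aeval_algHom_apply]⟩

theorem evalAt_map {Ω' : Type*} [Field Ω'] [Algebra K Ω'] (φ : Ω →ₐ[K] Ω')
    (P : AffinePoint h Ω) (a : CoordRing h) : (P.map φ).evalAt a = φ (P.evalAt a) := by
  obtain ⟨u, v, rfl⟩ := exists_eq_of_add_of_mul_root a
  simp [map, aeval_algHom_apply]

theorem evalAt_baseChange (P : AffinePoint h K) (a : CoordRing h) :
    (P.baseChange Ω).evalAt a = algebraMap K Ω (P.evalAt a) := by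
  obtain ⟨u, v, rfl⟩ := exists_eq_of_add_of_mul_root a
  simp [baseChange, aeval_algebraMap_apply]

/-- The curve is nonsingular: the maximal ideal of the local ring at `Q` is generated by one
element. If `y_Q = 0` this is `y`, because the minimal polynomial of `x_Q` divides `h` exactly once;
otherwise it is that minimal polynomial. -/
theorem exists_local_generator [CharZero K] (hsq : Squarefree h) (Q : AffinePoint h Ω) :
    ∃ π : CoordRing h, Q.evalAt π = 0 ∧
      ∀ a, Q.evalAt a = 0 → ∃ s t, Q.evalAt s ≠ 0 ∧ s * a = π * t := by
  have : CharZero Ω := charZero_of_injective_algebraMap (algebraMap K Ω).injective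
  by_cases hy : Q.y = 0
  · refine ⟨AdjoinRoot.root _, by simp [hy], fun a ha => ?_⟩
    obtain ⟨u, v, rfl⟩ := exists_eq_of_add_of_mul_root a
    have hu : aeval Q.x u = 0 := by simpa [hy] using ha
    have hh : aeval Q.x h = 0 := by rw [← Q.equation, hy]; simp
    obtain ⟨u', rfl⟩ := minpoly.dvd K Q.x hu
    obtain ⟨w, hw⟩ := minpoly.dvd K Q.x hh
    have hw0 : aeval Q.x w ≠ 0 := by
      intro h0
      obtain ⟨w', rfl⟩ := minpoly.dvd K Q.x h0
      refine minpoly.not_isUnit K Q.x (hsq _ ⟨w', ?_⟩)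
      rw [mul_assoc, ← hw]
    refine ⟨AdjoinRoot.of _ w, AdjoinRoot.root _ * AdjoinRoot.of _ u' +
      AdjoinRoot.of _ w * AdjoinRoot.of _ v, by simpa using hw0, ?_⟩
    have h1 : AdjoinRoot.root ((X : K[X][X]) ^ 2 - C h) ^ 2 =
        AdjoinRoot.of _ (minpoly K Q.x) * AdjoinRoot.of _ w := by
      rw [root_sq, ← map_mul, ← hw]
    rw [map_mul]
    linear_combination (-(AdjoinRoot.of _ u')) * h1
  · refine ⟨AdjoinRoot.of _ (minpoly K Q.x), by simp, fun a ha => ?_⟩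
    obtain ⟨u, v, rfl⟩ := exists_eq_of_add_of_mul_root a
    by_cases hc : aeval Q.x u - aeval Q.x v * Q.y = 0
    · have ha' : aeval Q.x u + aeval Q.x v * Q.y = 0 := by simpa using ha
      have hu : aeval Q.x u = 0 := by
        have : 2 * aeval Q.x u = 0 := by linear_combination hc + ha'
        simpa using this
      have hv : aeval Q.x v = 0 := by
        have : aeval Q.x v * Q.y = 0 := by linear_combination ha' - hu
        exact (mul_eq_zero.mp this).resolve_right hy
      obtain ⟨u', rfl⟩ := minpoly.dvd K Q.x hu
      obtain ⟨v', rfl⟩ := minpoly.dvd K Q.x hv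
      refine ⟨1, AdjoinRoot.of _ u' + AdjoinRoot.of _ v' * AdjoinRoot.root _, by simp, ?_⟩
      rw [map_mul, map_mul]
      ring
    · -- multiply by the conjugate, whose value at `Q` is not zero
      have hn : aeval Q.x (u ^ 2 - v ^ 2 * h) = 0 := by
        have ha' : aeval Q.x u + aeval Q.x v * Q.y = 0 := by simpa using ha
        simp only [map_sub, map_mul, map_pow, ← Q.equation]
        linear_combination (aeval Q.x u - aeval Q.x v * Q.y) * ha'
      obtain ⟨n, hn'⟩ := minpoly.dvd K Q.x hn
      refine ⟨AdjoinRoot.of _ u - AdjoinRoot.of _ v * AdjoinRoot.root _, AdjoinRoot.of _ n,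
        by simpa using hc, ?_⟩
      rw [← map_mul, ← hn']
      simp only [map_sub, map_mul, map_pow, ← root_sq]
      ring

/-- At a pole `Q` of `f` the inverse of `f` is regular and vanishes: the local ring at `Q` is a
valuation ring. -/
theorem IsPole.exists_mul_eq [CharZero K] (hsq : Squarefree h) (hodd : Odd h.natDegree)
    {f : RatFun h} {Q : AffinePoint h Ω} (hQ : Q.IsPole f) :
    ∃ a b : CoordRing h, algebraMap (CoordRing h) (RatFun h) a * f =
      algebraMap (CoordRing h) (RatFun h) b ∧ Q.evalAt a = 0 ∧ Q.evalAt b ≠ 0 := by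
  have := isDomain_coordRing hodd
  let M := RingHom.ker Q.evalAt
  have hM : M.IsPrime := RingHom.ker_isPrime _
  let V := Localization.AtPrime M
  have hnoeth : IsNoetherianRing (CoordRing h) := inferInstance
  have hnV : IsNoetherianRing V := IsLocalization.isNoetherianRing M.primeCompl V hnoeth
  have hdV : IsDomain V :=
    IsLocalization.isDomain_of_le_nonZeroDivisors _ M.primeCompl_le_nonZeroDivisors
  have hinj : Function.Injective (algebraMap (CoordRing h) V) :=
    IsLocalization.injective V M.primeCompl_le_nonZeroDivisors
  obtain ⟨π, hπ, hgen⟩ := exists_local_generator hsq Q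
  have hprin : (IsLocalRing.maximalIdeal V).IsPrincipal := by
    refine ⟨algebraMap (CoordRing h) V π, le_antisymm ?_ ?_⟩
    · intro z hz
      obtain ⟨a, s, rfl⟩ := IsLocalization.exists_mk'_eq M.primeCompl z
      have ha : Q.evalAt a = 0 := by
        rwa [IsLocalization.AtPrime.mk'_mem_maximal_iff V M] at hz
      obtain ⟨r, t, hr, hrt⟩ := hgen a ha
      have hr' : r ∈ M.primeCompl := hr
      refine Ideal.mem_span_singleton.mpr ⟨IsLocalization.mk' V t (⟨r, hr'⟩ * s), ?_⟩
      rw [IsLocalization.mul_mk'_eq_mk'_of_mul, ← hrt]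
      exact (IsLocalization.mk'_cancel a s ⟨r, hr'⟩).symm.trans (by rw [mul_comm, mul_comm s])
    · rw [Submodule.span_le, Set.singleton_subset_iff]
      exact (IsLocalization.AtPrime.to_map_mem_maximal_iff V M π).mpr hπ
  have hval : ValuationRing V :=
    ((tfae_of_isNoetherianRing_of_isLocalRing_of_isDomain V).out 4 1).mp hprin
  obtain ⟨a, b, hb, rfl⟩ := IsFractionRing.div_surjective (A := CoordRing h) f
  have hb0 : algebraMap (CoordRing h) (RatFun h) b ≠ 0 := by
    simpa using nonZeroDivisors.ne_zero hb
  -- descend a divisibility in the local ring to the coordinate ring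
  have descend : ∀ c d : CoordRing h, algebraMap _ V c ∣ algebraMap _ V d →
      ∃ s t, Q.evalAt s ≠ 0 ∧ s * d = c * t := by
    rintro c d ⟨z, hz⟩
    obtain ⟨t, s, rfl⟩ := IsLocalization.exists_mk'_eq M.primeCompl z
    refine ⟨s, t, s.2, hinj ?_⟩
    rw [map_mul, hz, map_mul, mul_left_comm, IsLocalization.mk'_spec']
  rcases ValuationRing.dvd_total (algebraMap _ V a) (algebraMap _ V b) with hd | hd
  · obtain ⟨s, t, hs, hst⟩ := descend _ _ hd
    have ha0 : algebraMap (CoordRing h) (RatFun h) a ≠ 0 := by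
      intro h0
      refine hQ ⟨0, 0, 1, by simp, ?_, by simp⟩
      simp [h0]
    have hmul : algebraMap (CoordRing h) (RatFun h) t *
        (algebraMap (CoordRing h) (RatFun h) a / algebraMap (CoordRing h) (RatFun h) b) =
        algebraMap (CoordRing h) (RatFun h) s := by
      rw [← mul_div_assoc, div_eq_iff hb0, ← map_mul, ← map_mul, hst, mul_comm]
    refine ⟨t, s, hmul, ?_, hs⟩
    by_contra ht
    exact hQ ⟨_, s, t, ht, hmul, rfl⟩
  · obtain ⟨s, t, hs, hst⟩ := descend _ _ hd
    refine (hQ ⟨_, t, s, hs, ?_, rfl⟩).elim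
    rw [← mul_div_assoc, div_eq_iff hb0, ← map_mul, ← map_mul, hst, mul_comm]

end AffinePoint

section Reduction

variable {L Γ : Type*} [Field L] [Algebra K L] [LinearOrderedCommGroupWithZero Γ]

/-- The values of a polynomial function at points with the same integral reduction have the same
integral reduction, for all valuations for which finitely many constants are integral. -/
theorem exists_finset_evalAt_congr (L : Type*) [Field L] [Algebra K L] (g : CoordRing h) :
    ∃ W : Finset L, ∀ v : Valuation L Γ, (∀ w ∈ W, v w ≤ 1) → ∀ P P' : AffinePoint h L,
      v P.x ≤ 1 → v P.y ≤ 1 → v P'.x ≤ 1 → v P'.y ≤ 1 → v (P.x - P'.x) < 1 →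
      v (P.y - P'.y) < 1 →
      v (P.evalAt g) ≤ 1 ∧ v (P'.evalAt g) ≤ 1 ∧ v (P.evalAt g - P'.evalAt g) < 1 := by
  classical
  let φ : CoordRing h → Prop := fun g =>
    ∃ W : Finset L, ∀ v : Valuation L Γ, (∀ w ∈ W, v w ≤ 1) → ∀ P P' : AffinePoint h L,
      v P.x ≤ 1 → v P.y ≤ 1 → v P'.x ≤ 1 → v P'.y ≤ 1 → v (P.x - P'.x) < 1 →
      v (P.y - P'.y) < 1 →
      v (P.evalAt g) ≤ 1 ∧ v (P'.evalAt g) ≤ 1 ∧ v (P.evalAt g - P'.evalAt g) < 1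
  have hadd : ∀ a b, φ a → φ b → φ (a + b) := by
    rintro a b ⟨W, hW⟩ ⟨W', hW'⟩
    refine ⟨W ∪ W', fun v hv P P' h1 h2 h3 h4 h5 h6 => ?_⟩
    obtain ⟨a1, a2, a3⟩ :=
      hW v (fun w hw => hv w (Finset.mem_union_left _ hw)) P P' h1 h2 h3 h4 h5 h6
    obtain ⟨b1, b2, b3⟩ :=
      hW' v (fun w hw => hv w (Finset.mem_union_right _ hw)) P P' h1 h2 h3 h4 h5 h6
    rw [RingHom.map_add P.evalAt, RingHom.map_add P'.evalAt, add_sub_add_comm]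
    exact ⟨v.map_add_le a1 b1, v.map_add_le a2 b2, v.map_add_lt a3 b3⟩
  have hmul : ∀ a b, φ a → φ b → φ (a * b) := by
    rintro a b ⟨W, hW⟩ ⟨W', hW'⟩
    refine ⟨W ∪ W', fun v hv P P' h1 h2 h3 h4 h5 h6 => ?_⟩
    obtain ⟨a1, a2, a3⟩ :=
      hW v (fun w hw => hv w (Finset.mem_union_left _ hw)) P P' h1 h2 h3 h4 h5 h6
    obtain ⟨b1, b2, b3⟩ :=
      hW' v (fun w hw => hv w (Finset.mem_union_right _ hw)) P P' h1 h2 h3 h4 h5 h6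
    have : P.evalAt a * P.evalAt b - P'.evalAt a * P'.evalAt b =
        P.evalAt a * (P.evalAt b - P'.evalAt b) + (P.evalAt a - P'.evalAt a) * P'.evalAt b := by
      ring
    rw [RingHom.map_mul P.evalAt, RingHom.map_mul P'.evalAt, this, Valuation.map_mul,
      Valuation.map_mul]
    refine ⟨mul_le_one' a1 b1, mul_le_one' a2 b2, v.map_add_lt ?_ ?_⟩
    · rw [map_mul]; exact (mul_le_of_le_one_left' a1).trans_lt b3
    · rw [map_mul]; exact (mul_le_of_le_one_right' b2).trans_lt a3
  have hC : ∀ c : K, φ (AdjoinRoot.of _ (C c)) := fun c =>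
    ⟨{algebraMap K L c}, fun v hv P P' _ _ _ _ _ _ => by
      have := hv _ (Finset.mem_singleton_self _)
      simpa using this⟩
  have hX : φ (AdjoinRoot.of _ X) := ⟨∅, fun v _ P P' h1 _ h3 _ h5 _ => by simpa using ⟨h1, h3, h5⟩⟩
  have hY : φ (AdjoinRoot.root _) := ⟨∅, fun v _ P P' _ h2 _ h4 _ h6 => by simpa using ⟨h2, h4, h6⟩⟩
  have hof : ∀ u : K[X], φ (AdjoinRoot.of _ u) := by
    intro u
    induction u using Polynomial.induction_on with
    | C c => exact hC c
    | add p q hp hq => rw [map_add]; exact hadd _ _ hp hq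
    | monomial n c hn => 
      rw [show C c * X ^ (n + 1) = (C c * X ^ n) * X by ring, map_mul]
      exact hmul _ _ hn hX
  obtain ⟨u, v, rfl⟩ := exists_eq_of_add_of_mul_root g
  exact hadd _ _ (hof u) (hmul _ _ (hof v) hY)

/-- A point where `f` is integral does not reduce to a pole `Q` of `f`. -/
theorem exists_finset_not_congr_pole {f : RatFun h} (Q : AffinePoint h L)
    {a b : CoordRing h} (hab : algebraMap (CoordRing h) (RatFun h) a * f =
      algebraMap (CoordRing h) (RatFun h) b) (ha : Q.evalAt a = 0) (hb : Q.evalAt b ≠ 0) :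
    ∃ W : Finset L, ∀ v : Valuation L Γ, (∀ w ∈ W, w ≠ 0 → v w = 1) →
      ∀ (P : AffinePoint h K) (c : K), P.HasValueAt f c → v (algebraMap K L c) ≤ 1 →
        v (algebraMap K L P.x - Q.x) < 1 → ¬ v (algebraMap K L P.y - Q.y) < 1 := by
  classical
  obtain ⟨Wa, hWa⟩ := exists_finset_evalAt_congr (Γ := Γ) L a
  obtain ⟨Wb, hWb⟩ := exists_finset_evalAt_congr (Γ := Γ) L b
  refine ⟨Wa ∪ Wb ∪ {Q.x, Q.y, Q.evalAt b}, fun v hv P c hc hvc hx hy => ?_⟩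
  have hle : ∀ w ∈ Wa ∪ Wb ∪ {Q.x, Q.y, Q.evalAt b}, v w ≤ 1 := by
    intro w hw
    by_cases h0 : w = 0
    · simp [h0]
    · exact (hv w hw h0).le
  have hQx : v Q.x ≤ 1 := hle _ (by simp)
  have hQy : v Q.y ≤ 1 := hle _ (by simp)
  have hPx : v (algebraMap K L P.x) ≤ 1 := by
    have := v.map_add_le hx.le hQx
    simpa using this
  have hPy : v (algebraMap K L P.y) ≤ 1 := by
    have := v.map_add_le hy.le hQy
    simpa using this
  obtain ⟨-, -, ha'⟩ := hWa v (fun w hw => hle w (by simp [hw])) (P.baseChange L) Q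
    hPx hPy hQx hQy hx hy
  obtain ⟨-, -, hb'⟩ := hWb v (fun w hw => hle w (by simp [hw])) (P.baseChange L) Q
    hPx hPy hQx hQy hx hy
  rw [AffinePoint.evalAt_baseChange, ha, sub_zero] at ha'
  rw [AffinePoint.evalAt_baseChange] at hb'
  have hb1 : v (Q.evalAt b) = 1 := hv _ (by simp) hb
  have hb2 : v (algebraMap K L (P.evalAt b)) = 1 := by
    rw [← hb1]
    apply v.map_eq_of_sub_lt
    rwa [hb1]
  obtain ⟨a', b', hb'0, hab', rfl⟩ := hc
  have h1 : a * a' = b * b' := by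
    apply IsFractionRing.injective (CoordRing h) (RatFun h)
    rw [map_mul, map_mul, ← hab, ← hab']
    ring
  have h2 : P.evalAt a * (P.evalAt a' / P.evalAt b') = P.evalAt b := by
    rw [← mul_div_assoc, div_eq_iff hb'0, ← map_mul, ← map_mul, h1]
  rw [← h2, map_mul, map_mul] at hb2
  exact ((mul_le_of_le_one_right' hvc).trans_lt ha').ne hb2

end Reduction

end Curve

/-! ### Binary forms as products of linear factors -/

section Forms

namespace BinaryForm

variable {K : Type*} [Field K] {n : ℕ}

/-- The binary form `∏ (Aⱼ X - Bⱼ Z)`, with roots `Bⱼ / Aⱼ`. -/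
def ofLinearFactors (A B : Fin n → K) : BinaryForm K n :=
  ⟨∏ j, (MvPolynomial.C (A j) * MvPolynomial.X 0 - MvPolynomial.C (B j) * MvPolynomial.X 1), by
    have := MvPolynomial.IsHomogeneous.prod (Finset.univ : Finset (Fin n))
      (fun j => (MvPolynomial.C (A j) * MvPolynomial.X 0 -
        MvPolynomial.C (B j) * MvPolynomial.X 1 : MvPolynomial (Fin 2) K)) (fun _ => 1)
      (fun j _ => by
        simpa using ((MvPolynomial.isHomogeneous_C (Fin 2) (A j)).mul
          (MvPolynomial.isHomogeneous_X K (0 : Fin 2))).sub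
          ((MvPolynomial.isHomogeneous_C (Fin 2) (B j)).mul
          (MvPolynomial.isHomogeneous_X K (1 : Fin 2))))
    simpa using this⟩

theorem ofRoots_eq_ofLinearFactors (β : Fin n → K) :
    ofRoots β = ofLinearFactors (fun _ => 1) (Fin.cons 1 β) := by
  apply Subtype.ext
  simp [ofRoots, ofLinearFactors, Fin.prod_univ_succ]

theorem dehomog_ofLinearFactors (A B : Fin n → K) :
    (ofLinearFactors A B).dehomog = ∏ j, (C (A j) * X - C (B j)) := by
  simp [dehomog, ofLinearFactors, map_prod, algebraMap_eq]

/-- Substituting and rescaling the linear factors does not change the class. -/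
theorem cls_ofLinearFactors_eq (U : GL (Fin 2) K) (l : Fin n → K) (hl : ∀ j, l j ≠ 0)
    (γ : Fin n → K) :
    (ofLinearFactors (fun j => l j * (U 0 0 - γ j * U 1 0))
      (fun j => l j * (γ j * U 1 1 - U 0 1))).cls = (ofLinearFactors (fun _ => 1) γ).cls := by
  have h : Equivalent (ofLinearFactors (fun _ => 1) γ)
      (ofLinearFactors (fun j => l j * (U 0 0 - γ j * U 1 0))
        (fun j => l j * (γ j * U 1 1 - U 0 1))) := by
    refine ⟨U, Units.mk0 (∏ j, l j) (Finset.prod_ne_zero_iff.mpr fun j _ => hl j), ?_⟩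
    simp only [ofLinearFactors, substPoly, map_prod, Units.val_mk0]
    rw [← Finset.prod_mul_distrib]
    refine Finset.prod_congr rfl fun j _ => ?_
    simp only [map_sub, map_mul, MvPolynomial.aeval_X, MvPolynomial.algHom_C,
      MvPolynomial.algebraMap_eq, map_one]
    ring
  exact (Quotient.sound (s := equivSetoid K n) h).symm

theorem isSIntegral_ofLinearFactors [NumberField K] {T : Finset (HeightOneSpectrum (𝓞 K))}
    {A B : Fin n → K} (hA : ∀ p ∉ T, ∀ j, p.valuation K (A j) ≤ 1)
    (hB : ∀ p ∉ T, ∀ j, p.valuation K (B j) ≤ 1) : (ofLinearFactors A B).IsSIntegral T := by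
  let R := (T : Set (HeightOneSpectrum (𝓞 K))).integer K
  let F : MvPolynomial (Fin 2) R := ∏ j,
    (MvPolynomial.C ⟨A j, fun p hp => hA p hp j⟩ * MvPolynomial.X 0 -
      MvPolynomial.C ⟨B j, fun p hp => hB p hp j⟩ * MvPolynomial.X 1)
  have hF : (ofLinearFactors A B).1 = MvPolynomial.map (algebraMap R K) F := by
    simp only [ofLinearFactors, F, map_prod, map_sub, map_mul, MvPolynomial.map_C,
      MvPolynomial.map_X]
    rfl
  intro d
  rw [hF, MvPolynomial.coeff_map]
  exact (F.coeff d).2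

/-- The discriminant of a product of linear factors is, up to sign, the product of the
determinants of all ordered pairs of factors. -/
theorem disc_ofLinearFactors (hn : 2 ≤ n) {A B : Fin n → K} (hA : ∀ j, A j ≠ 0) :
    ∃ e : ℕ, (ofLinearFactors A B).disc =
      (-1) ^ e * ∏ j, ∏ i ∈ Finset.univ.erase j, (A i * B j - A j * B i) := by
  classical
  set f := (ofLinearFactors A B).dehomog with hf
  have hfprod : f = ∏ j, (C (A j) * X - C (B j)) := dehomog_ofLinearFactors A B
  have hfac : ∀ j, C (A j) * X - C (B j) = C (A j) * (X - C (B j / A j)) := fun j => by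
    rw [mul_sub, ← C_mul, mul_div_cancel₀ _ (hA j)]
  have hlc0 : ∏ j, A j ≠ 0 := Finset.prod_ne_zero_iff.mpr fun j _ => hA j
  have hf2 : f = C (∏ j, A j) * ∏ j, (X - C (B j / A j)) := by
    rw [hfprod, map_prod, ← Finset.prod_mul_distrib]
    exact Finset.prod_congr rfl fun j _ => hfac j
  have hmonic : (∏ j, (X - C (B j / A j))).Monic :=
    monic_prod_of_monic _ _ fun j _ => monic_X_sub_C _
  have hdeg : f.natDegree = n := by
    rw [hf2, natDegree_C_mul hlc0, natDegree_prod_of_monic _ _ fun j _ => monic_X_sub_C _]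
    simp
  have hlc : f.leadingCoeff = ∏ j, A j := by
    rw [hf2, leadingCoeff_mul, hmonic.leadingCoeff, leadingCoeff_C, mul_one]
  have hroots : f.roots = Finset.univ.val.map fun j => B j / A j := by
    rw [hf2, roots_C_mul _ hlc0]
    exact roots_multiset_prod_X_sub_C (Finset.univ.val.map fun j => B j / A j) ▸ by
      rw [Multiset.map_map]; rfl
  have hsplits : f.Splits := by
    rw [hf2]
    exact (Splits.C _).mul (Splits.prod fun j _ => Splits.X_sub_C _)
  have hder : ∀ j, f.derivative.eval (B j / A j) * A j ^ (n - 1) =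
      A j * ∏ i ∈ Finset.univ.erase j, (A i * B j - A j * B i) := by
    intro j
    rw [hfprod, derivative_prod_finset, eval_finsetSum, Finset.sum_eq_single j]
    · rw [eval_mul, eval_prod, mul_right_comm, mul_comm]
      congr 1
      · simp
      · have hcard : (Finset.univ.erase j).card = n - 1 := by simp
        rw [← hcard, ← Finset.prod_const, ← Finset.prod_mul_distrib]
        refine Finset.prod_congr rfl fun i _ => ?_
        have := hA j
        simp
        field_simp
    · intro i _ hij
      rw [eval_mul, eval_prod, Finset.prod_eq_zero (i := j), zero_mul]
      · simpa using Ne.symm hij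
      · simp [mul_div_cancel₀ _ (hA j)]
    · simp
  have hres : resultant f f.derivative f.natDegree (f.natDegree - 1) =
      (∏ j, A j) * ∏ j, ∏ i ∈ Finset.univ.erase j, (A i * B j - A j * B i) := by
    rw [resultant_eq_prod_eval f _ _ (natDegree_derivative_le f) hsplits, hlc, hroots,
      Multiset.map_map, hdeg, ← Finset.prod_mul_distrib]
    simp_rw [← hder]
    rw [Finset.prod_mul_distrib, Finset.prod_pow, mul_comm]
    rfl
  have hpos : 0 < f.degree := by
    rw [← natDegree_pos_iff_degree_pos]; omega
  rw [resultant_deriv hpos, hlc] at hres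
  refine ⟨f.natDegree * (f.natDegree - 1) / 2, ?_⟩
  rw [disc, if_neg (by omega), if_pos hdeg, ← hf]
  have h1 := mul_left_cancel₀ hlc0 ((by rw [← hres]; ring) :
    (∏ j, A j) * ((-1) ^ (f.natDegree * (f.natDegree - 1) / 2) * f.discr) = _ * _)
  rw [← h1, ← mul_assoc, ← mul_pow]
  simp

theorem valuation_disc_ofLinearFactors {Γ : Type*} [LinearOrderedCommGroupWithZero Γ]
    (v : Valuation K Γ) (hn : 2 ≤ n) {A B : Fin n → K} (hA : ∀ j, A j ≠ 0) :
    v (ofLinearFactors A B).disc =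
      ∏ j, ∏ i ∈ Finset.univ.erase j, v (A i * B j - A j * B i) := by
  obtain ⟨e, he⟩ := disc_ofLinearFactors hn hA (B := B)
  rw [he, map_mul, map_pow, Valuation.map_neg, map_one, one_pow, one_mul, map_prod]
  exact Finset.prod_congr rfl fun j _ => map_prod _ _ _

theorem isRoot_dehomog_ofLinearFactors {A B : Fin n → K} (j : Fin n) (hA : A j ≠ 0) :
    (ofLinearFactors A B).dehomog.IsRoot (B j / A j) := by
  rw [dehomog_ofLinearFactors, IsRoot, eval_prod, Finset.prod_eq_zero (Finset.mem_univ j)]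
  simp [mul_div_cancel₀ _ hA]

end BinaryForm

end Forms

/-! ### Distances of the square roots at one prime -/

section Local

variable {L Γ : Type*} [Field L] [LinearOrderedCommGroupWithZero Γ] {v : Valuation L Γ}

theorem eq_of_mul_eq_mul_self {a b m : Γ} (ha : a ≤ m) (hb : b ≤ m) (h : a * b = m * m) :
    a = m := by
  refine le_antisymm ha (le_of_not_gt fun hlt => ?_)
  have hm : 0 < m := zero_le.trans_lt hlt
  have h1 : a * b ≤ a * m := by gcongr
  have h2 : a * m < m * m := by gcongr
  exact (h1.trans_lt h2).ne h

theorem le_one_of_sq_le_one {a : Γ} (h : a ^ 2 ≤ 1) : a ≤ 1 := by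
  by_contra! h'
  exact (one_lt_pow₀ h' two_ne_zero).not_ge h

/-- Of `u` and `u + 2` the larger one has valuation `max 1 v(u)`. -/
theorem max_valuation_add_two (h2 : v 2 = 1) (u : L) :
    max (v (u + 2)) (v u) = max 1 (v u) := by
  rcases lt_trichotomy (v u) 1 with h | h | h
  · rw [v.map_add_eq_of_lt_right (by rwa [h2]), h2]
  · rw [h, max_self, max_eq_right]
    exact v.map_add_le h.le h2.le
  · rw [v.map_add_eq_of_lt_left (by rwa [h2]), max_self, max_eq_right h.le]

theorem valuation_prod_sub_prod_lt_one {ι : Type*} (s : Finset ι) {b c : ι → L}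
    (hb : ∀ i, v (b i) ≤ 1) (hc : ∀ i, v (c i) ≤ 1) (h : ∀ i, v (b i - c i) < 1) :
    v (∏ i ∈ s, b i - ∏ i ∈ s, c i) < 1 := by
  classical
  induction s using Finset.induction_on with
  | empty => simp
  | insert i s hi ih =>
    rw [Finset.prod_insert hi, Finset.prod_insert hi]
    have : b i * ∏ j ∈ s, b j - c i * ∏ j ∈ s, c j =
        b i * (∏ j ∈ s, b j - ∏ j ∈ s, c j) + (b i - c i) * ∏ j ∈ s, c j := by ring
    rw [this]
    refine v.map_add_lt ?_ ?_
    · rw [map_mul]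
      exact (mul_le_of_le_one_left' (hb i)).trans_lt ih
    · rw [map_mul, map_prod]
      exact (mul_le_of_le_one_right' (Finset.prod_le_one' fun j _ => hc j)).trans_lt (h i)

/-- The larger of the valuations of the two coefficients of `(c + 2 - γ) X - τ (c - γ) Z`. -/
def content (v : Valuation L Γ) (c τ γ : L) : Γ :=
  max (v (c + 2 - γ)) (v (τ * (c - γ)))

/-- Any two of the linear factors `(c + 2 - γⱼ) X - τ (c - γⱼ) Z`, once divided by their contents,
have a determinant of valuation `1`. The determinant of the undivided factors is `2τ (γᵢ - γⱼ)`, and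
`2` is a unit wherever this is used. -/
def UnitDeterminants {ι : Type*} (v : Valuation L Γ) (c τ : L) (γ : ι → L) : Prop :=
  ∀ i j, i ≠ j → v τ * v (γ i - γ j) = content v c τ (γ i) * content v c τ (γ j)

theorem unitDeterminants_cons {n : ℕ} {c τ : L} {b : Fin n → L}
    (h0 : ∀ j, v τ * v (1 - b j) = content v c τ 1 * content v c τ (b j))
    (h : UnitDeterminants v c τ b) :
    UnitDeterminants v c τ (Fin.cons 1 b : Fin (n + 1) → L) := by
  intro i j
  refine Fin.cases ?_ (fun i => ?_) i <;> refine Fin.cases ?_ (fun j => ?_) j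
  · simp
  · intro _
    simpa using h0 j
  · intro _
    rw [v.map_sub_swap, mul_comm (content _ _ _ _)]
    simpa using h0 i
  · intro hij
    simpa using h i j (by rintro rfl; exact hij rfl)

section SqrtChoice

variable {n : ℕ} {a b : Fin n → L} {x xQ : L}

theorem sq_sub_one_eq (hx : ∀ i, x ≠ a i) (hb : ∀ i, b i ^ 2 = (xQ - a i) / (x - a i)) (i : Fin n) :
    (b i - 1) * (b i + 1) = (xQ - x) / (x - a i) := by
  have h := sub_ne_zero.mpr (hx i)
  have : (b i - 1) * (b i + 1) = b i ^ 2 - 1 := by ring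
  rw [this, hb]
  field_simp
  ring

theorem sq_sub_sq_eq (hx : ∀ i, x ≠ a i) (hb : ∀ i, b i ^ 2 = (xQ - a i) / (x - a i))
    (i j : Fin n) :
    (b i - b j) * (b i + b j) = (a i - a j) * (xQ - x) / ((x - a i) * (x - a j)) := by
  have h := sub_ne_zero.mpr (hx i)
  have h' := sub_ne_zero.mpr (hx j)
  have : (b i - b j) * (b i + b j) = b i ^ 2 - b j ^ 2 := by ring
  rw [this, hb, hb]
  field_simp
  ring

/-- The case where `P` reduces to the point at infinity: all `βᵢ` are close to `0`. -/
theorem unitDeterminants_of_one_lt {c τ : L} (h2 : v 2 = 1) (ha : ∀ i, v (a i) ≤ 1)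
    (haa : ∀ i j, i ≠ j → v (a i - a j) = 1) (hxQ : v xQ ≤ 1)
    (hx : ∀ i, x ≠ a i) (hb : ∀ i, b i ^ 2 = (xQ - a i) / (x - a i))
    (hvx : 1 < v x) (hτ : v τ ^ 2 = v x) (hc : v (τ * c) ≤ 1) :
    UnitDeterminants v c τ (Fin.cons 1 b : Fin (n + 1) → L) := by
  have hx0 : v x ≠ 0 := (zero_lt_one.trans hvx).ne'
  have hτ1 : 1 < v τ := by
    by_contra! h
    rw [← hτ] at hvx
    exact hvx.not_ge (pow_le_one' h 2)
  have hxa : ∀ i, v (x - a i) = v x := fun i =>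
    v.map_sub_eq_of_lt_left ((ha i).trans_lt hvx)
  have hxx : v (xQ - x) = v x := v.map_sub_eq_of_lt_right (hxQ.trans_lt hvx)
  have small : ∀ u, v (τ * u) ≤ 1 → v u < 1 := by
    intro u hu
    by_contra! h
    rw [map_mul] at hu
    exact (hτ1.trans_le (le_mul_of_one_le_right' h)).not_ge hu
  have hτb : ∀ i, v (τ * b i) ≤ 1 := by
    intro i
    apply le_one_of_sq_le_one
    rw [map_mul, mul_pow, ← map_pow v (b i), hb, map_div₀, hxa, hτ, mul_div_cancel₀ _ hx0]
    exact v.map_sub_le hxQ (ha i)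
  have hc' := small c hc
  have hb' := fun i => small _ (hτb i)
  have M0 : content v c τ 1 = v τ := by
    have e1 : v (c + 2 - 1) = 1 := by
      rw [show c + 2 - 1 = c + 1 by ring, v.map_add_eq_of_lt_right (by simpa using hc'), map_one]
    have e2 : v (τ * (c - 1)) = v τ := by
      rw [map_mul, v.map_sub_eq_of_lt_right (by simpa using hc'), map_one, mul_one]
    rw [content, e1, e2, max_eq_right hτ1.le]
  have M : ∀ i, content v c τ (b i) = 1 := by
    intro i
    have e1 : v (c + 2 - b i) = 1 := by
      rw [show c + 2 - b i = (c - b i) + 2 by ring,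
        v.map_add_eq_of_lt_right (by rw [h2]; exact v.map_sub_lt hc' (hb' i)), h2]
    rw [content, e1, max_eq_left]
    rw [mul_sub]
    exact v.map_sub_le hc (hτb i)
  refine unitDeterminants_cons (fun j => ?_) fun i j hij => ?_
  · rw [M0, M, v.map_sub_eq_of_lt_left (by simpa using hb' j), map_one]
  · rw [M, M, mul_one, ← map_mul]
    refine eq_of_mul_eq_mul_self (b := v (τ * (b i + b j))) ?_ ?_ ?_
    · rw [mul_sub]; exact v.map_sub_le (hτb i) (hτb j)
    · rw [mul_add]; exact v.map_add_le (hτb i) (hτb j)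
    · rw [← map_mul, show τ * (b i - b j) * (τ * (b i + b j)) =
        τ ^ 2 * ((b i - b j) * (b i + b j)) by ring, sq_sub_sq_eq hx hb]
      simp only [map_mul, map_div₀, map_pow, haa i j hij, hxx, hxa, hτ]
      field_simp

/-- The case where `P` reduces to an affine point with `x`-coordinate different from that of
`Q`. -/
theorem unitDeterminants_of_valuation_sub_eq_one {c τ : L} (h2 : v 2 = 1)
    (ha : ∀ i, v (a i) ≤ 1) (haa : ∀ i j, i ≠ j → v (a i - a j) = 1)
    (hx : ∀ i, x ≠ a i) (hb : ∀ i, b i ^ 2 = (xQ - a i) / (x - a i))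
    (hvx : v x ≤ 1) (hxx : v (xQ - x) = 1) (hτ : v τ = 1) (hc : v c ≤ 1) :
    UnitDeterminants v c τ (Fin.cons 1 b : Fin (n + 1) → L) := by
  have M : ∀ γ, content v c τ γ = max 1 (v γ) := by
    intro γ
    rw [content, map_mul, hτ, one_mul, show c + 2 - γ = (c - γ) + 2 by ring,
      max_valuation_add_two h2]
    rcases le_or_gt (v γ) 1 with h | h
    · rw [max_eq_left h, max_eq_left (v.map_sub_le hc h)]
    · rw [v.map_sub_eq_of_lt_right (hc.trans_lt h)]
  have hw0 : ∀ i, v (x - a i) ≠ 0 := fun i =>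
    (Valuation.ne_zero_iff _).mpr (sub_ne_zero.mpr (hx i))
  have hw1 : ∀ i, v (x - a i) ≤ 1 := fun i => v.map_sub_le hvx (ha i)
  have hprod : ∀ i, v (b i - 1) * v (b i + 1) = (v (x - a i))⁻¹ := by
    intro i
    rw [← map_mul, sq_sub_one_eq hx hb, map_div₀, hxx, one_div]
  have Msq : ∀ i, max 1 (v (b i)) * max 1 (v (b i)) = (v (x - a i))⁻¹ := by
    intro i
    rw [← hprod]
    rcases le_or_gt (v (b i)) 1 with h | h
    · rw [max_eq_left h, mul_one]
      refine le_antisymm ?_ ?_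
      · rw [hprod]
        exact (one_le_inv₀ (zero_lt_iff.mpr (hw0 i))).mpr (hw1 i)
      · exact mul_le_one' (v.map_sub_le h v.map_one.le) (v.map_add_le h v.map_one.le)
    · rw [max_eq_right h.le, v.map_sub_eq_of_lt_left (by simpa using h),
        v.map_add_eq_of_lt_left (by simpa using h)]
  have M0 : content v c τ 1 = 1 := by rw [M]; simp
  refine unitDeterminants_cons (fun j => ?_) fun i j hij => ?_
  · rw [M0, M, hτ, one_mul, one_mul, v.map_sub_swap]
    have h1 : v 1 ≤ max 1 (v (b j)) := by simp
    refine eq_of_mul_eq_mul_self (b := v (b j + 1)) ?_ ?_ ?_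
    · exact v.map_sub_le (le_max_right _ _) h1
    · exact v.map_add_le (le_max_right _ _) h1
    · rw [hprod, Msq]
  · rw [M, M, hτ, one_mul]
    have hi : v (b i) ≤ max 1 (v (b i)) * max 1 (v (b j)) :=
      (le_max_right _ _).trans (le_mul_of_one_le_right' (le_max_left _ _))
    have hj : v (b j) ≤ max 1 (v (b i)) * max 1 (v (b j)) :=
      (le_max_right _ _).trans (le_mul_of_one_le_left' (le_max_left _ _))
    refine eq_of_mul_eq_mul_self (b := v (b i + b j)) (v.map_sub_le hi hj) (v.map_add_le hi hj) ?_
    rw [mul_mul_mul_comm, Msq, Msq, ← map_mul, sq_sub_sq_eq hx hb]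
    simp only [map_mul, map_div₀, haa i j hij, hxx]
    field_simp

end SqrtChoice

/-- The `γⱼ` with `j ∈ N` are close to `-1` and the others are close to `1`. The distance is exactly
`ε` in the first case, while `γⱼ = 1` is allowed in the second; the last condition gives the
distances inside each of the two clusters. -/
structure TwoClusters {ι : Type*} (v : Valuation L Γ) (ε : Γ) (γ : ι → L) (N : Finset ι) :
    Prop where
  lt_one : ε < 1
  add_one : ∀ j ∈ N, v (γ j + 1) = ε
  sub_one : ∀ j ∉ N, v (γ j - 1) ≤ ε
  sq_sub_sq : ∀ i j, i ≠ j → v ((γ i - γ j) * (γ i + γ j)) = ε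

namespace TwoClusters

variable {ι : Type*} {ε : Γ} {γ : ι → L} {N : Finset ι} {c τ : L}

theorem valuation_sub_of_mem (H : TwoClusters v ε γ N) (h2 : v 2 = 1) {i j : ι} (hij : i ≠ j)
    (hi : i ∈ N) (hj : j ∈ N) : v (γ i - γ j) = ε := by
  have h : v (γ i + γ j) = 1 := by
    rw [show γ i + γ j = ((γ i + 1) + (γ j + 1)) - 2 by ring, v.map_sub_eq_of_lt_right, h2]
    rw [h2]
    exact v.map_add_lt (by rw [H.add_one i hi]; exact H.lt_one)
      (by rw [H.add_one j hj]; exact H.lt_one)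
  have := H.sq_sub_sq i j hij
  rwa [map_mul, h, mul_one] at this

theorem valuation_sub_of_notMem (H : TwoClusters v ε γ N) (h2 : v 2 = 1) {i j : ι} (hij : i ≠ j)
    (hi : i ∉ N) (hj : j ∉ N) : v (γ i - γ j) = ε := by
  have h : v (γ i + γ j) = 1 := by
    rw [show γ i + γ j = ((γ i - 1) + (γ j - 1)) + 2 by ring, v.map_add_eq_of_lt_right, h2]
    rw [h2]
    exact v.map_add_lt ((H.sub_one i hi).trans_lt H.lt_one) ((H.sub_one j hj).trans_lt H.lt_one)
  have := H.sq_sub_sq i j hij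
  rwa [map_mul, h, mul_one] at this

theorem valuation_sub_of_mem_of_notMem (H : TwoClusters v ε γ N) (h2 : v 2 = 1) {i j : ι}
    (hi : i ∈ N) (hj : j ∉ N) : v (γ i - γ j) = 1 := by
  rw [show γ i - γ j = ((γ i + 1) - (γ j - 1)) - 2 by ring, v.map_sub_eq_of_lt_right, h2]
  rw [h2]
  exact v.map_sub_lt (by rw [H.add_one i hi]; exact H.lt_one)
    ((H.sub_one j hj).trans_lt H.lt_one)

theorem valuation_left_of_mem (H : TwoClusters v ε γ N) (h2 : v 2 = 1) (hc : v (c + 1) < ε)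
    {j : ι} (hj : j ∈ N) : v (c + 2 - γ j) = 1 := by
  rw [show c + 2 - γ j = ((c + 1) - (γ j + 1)) + 2 by ring, v.map_add_eq_of_lt_right, h2]
  rw [h2]
  exact v.map_sub_lt (hc.trans H.lt_one) (by rw [H.add_one j hj]; exact H.lt_one)

theorem valuation_right_of_mem (H : TwoClusters v ε γ N) (hc : v (c + 1) < ε)
    {j : ι} (hj : j ∈ N) : v (τ * (c - γ j)) = v τ * ε := by
  rw [map_mul, show c - γ j = (c + 1) - (γ j + 1) by ring, v.map_sub_eq_of_lt_right,
    H.add_one j hj]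
  rwa [H.add_one j hj]

theorem valuation_left_of_notMem (H : TwoClusters v ε γ N) (hc : v (c + 1) < ε)
    {j : ι} (hj : j ∉ N) : v (c + 2 - γ j) ≤ ε := by
  rw [show c + 2 - γ j = (c + 1) - (γ j - 1) by ring]
  exact v.map_sub_le hc.le (H.sub_one j hj)

theorem valuation_right_of_notMem (H : TwoClusters v ε γ N) (h2 : v 2 = 1) (hc : v (c + 1) < ε)
    {j : ι} (hj : j ∉ N) : v (τ * (c - γ j)) = v τ := by
  rw [map_mul, show c - γ j = ((c + 1) - (γ j - 1)) - 2 by ring, v.map_sub_eq_of_lt_right, h2,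
    mul_one]
  rw [h2]
  exact v.map_sub_lt (hc.trans H.lt_one) ((H.sub_one j hj).trans_lt H.lt_one)

theorem content_of_mem (H : TwoClusters v ε γ N) (h2 : v 2 = 1) (hc : v (c + 1) < ε)
    (hτ : v τ * ε ≤ 1) {j : ι} (hj : j ∈ N) : content v c τ (γ j) = 1 := by
  rw [content, H.valuation_left_of_mem h2 hc hj, H.valuation_right_of_mem hc hj, max_eq_left hτ]

theorem content_of_notMem (H : TwoClusters v ε γ N) (h2 : v 2 = 1) (hc : v (c + 1) < ε)
    (hτ : ε ≤ v τ) {j : ι} (hj : j ∉ N) : content v c τ (γ j) = v τ := by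
  rw [content, H.valuation_right_of_notMem h2 hc hj,
    max_eq_right ((H.valuation_left_of_notMem hc hj).trans hτ)]

/-- When at most one `γⱼ` is not close to `-1`, scaling by `ε⁻¹` separates the cluster at `-1` and
leaves no other one. -/
theorem unitDeterminants (H : TwoClusters v ε γ N) (h2 : v 2 = 1) (hc : v (c + 1) < ε)
    (hτ : v τ * ε = 1) (hN : ∀ i j, i ∉ N → j ∉ N → i = j) : UnitDeterminants v c τ γ := by
  have hτ' : ε ≤ v τ := by
    by_contra! h
    have h3 : v τ * ε ≤ ε := mul_le_of_le_one_left' (h.trans H.lt_one).le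
    rw [hτ] at h3
    exact h3.not_gt H.lt_one
  have hin := fun {j} => H.content_of_mem h2 hc hτ.le (j := j)
  have hout := fun {j} => H.content_of_notMem h2 hc hτ' (j := j)
  intro i j hij
  by_cases hi : i ∈ N <;> by_cases hj : j ∈ N
  · rw [hin hi, hin hj, H.valuation_sub_of_mem h2 hij hi hj, hτ, mul_one]
  · rw [hin hi, hout hj, H.valuation_sub_of_mem_of_notMem h2 hi hj, one_mul, mul_one]
  · rw [hout hi, hin hj, v.map_sub_swap, H.valuation_sub_of_mem_of_notMem h2 hj hi]
  · exact (hij (hN i j hi hj)).elim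

end TwoClusters

section SqrtChoice

variable {n : ℕ} {a b : Fin n → L} {x xQ : L}

/-- The case where `P` reduces to the conjugate of `Q`: an odd number of the `βᵢ` is close to `-1`,
the other ones are close to `1`. -/
theorem exists_twoClusters (h2 : v 2 = 1) (haa : ∀ i j, i ≠ j → v (a i - a j) = 1)
    (hxQa : ∀ i, v (xQ - a i) = 1) (hx : ∀ i, x ≠ a i)
    (hb : ∀ i, b i ^ 2 = (xQ - a i) / (x - a i)) (hxx : v (xQ - x) < 1)
    (hprod : v (∏ i, b i + 1) < 1) :
    ∃ N : Finset (Fin n), Odd N.card ∧ TwoClusters v (v (xQ - x)) (Fin.cons 1 b : Fin (n + 1) → L)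
      (N.map (Fin.succEmb n)) := by
  classical
  have hxa : ∀ i, v (x - a i) = 1 := by
    intro i
    rw [show x - a i = (xQ - a i) - (xQ - x) by ring, v.map_sub_eq_of_lt_left, hxQa]
    rwa [hxQa]
  have hvb : ∀ i, v (b i) ≤ 1 := by
    intro i
    apply le_one_of_sq_le_one
    rw [← map_pow, hb, map_div₀, hxQa, hxa, div_one]
  have hsq : ∀ i, v (b i - 1) * v (b i + 1) = v (xQ - x) := by
    intro i
    rw [← map_mul, sq_sub_one_eq hx hb, map_div₀, hxa, div_one]
  let N : Finset (Fin n) := {i | v (b i + 1) < 1}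
  have hin : ∀ i ∈ N, v (b i + 1) = v (xQ - x) := by
    intro i hi
    have hi' : v (b i + 1) < 1 := by simpa [N] using hi
    have h1 : v (b i - 1) = 1 := by
      rw [show b i - 1 = (b i + 1) - 2 by ring, v.map_sub_eq_of_lt_right, h2]
      rwa [h2]
    rw [← hsq i, h1, one_mul]
  have hout : ∀ i ∉ N, v (b i - 1) = v (xQ - x) := by
    intro i hi
    have hi' : 1 ≤ v (b i + 1) := by simpa [N] using hi
    have h1 : v (b i + 1) = 1 := le_antisymm (v.map_add_le (hvb i) v.map_one.le) hi'
    rw [← hsq i, h1, mul_one]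
  refine ⟨N, ?_, hxx, ?_, ?_, ?_⟩
  · -- modulo the valuation ideal, `-1 = ∏ βᵢ = (-1) ^ N.card`
    by_contra hodd
    have heven := Nat.not_odd_iff_even.mp hodd
    have h1 := valuation_prod_sub_prod_lt_one (v := v) Finset.univ
      (c := fun i => if i ∈ N then -1 else 1) hvb (fun i => by split_ifs <;> simp) (fun i => by
        split_ifs with hi
        · rw [sub_neg_eq_add, hin i hi]; exact hxx
        · rw [hout i hi]; exact hxx)
    rw [Finset.prod_ite_mem, Finset.univ_inter, Finset.prod_const, heven.neg_one_pow] at h1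
    have h3 := v.map_sub_lt hprod h1
    rw [show ∏ i, b i + 1 - (∏ i, b i - 1) = 2 by ring, h2] at h3
    exact lt_irrefl _ h3
  · intro j hj
    obtain ⟨i, hi, rfl⟩ := Finset.mem_map.mp hj
    simpa using hin i hi
  · intro j
    refine Fin.cases (by simp) (fun i => ?_) j
    intro hi
    have hi' : i ∉ N := fun h => hi (Finset.mem_map_of_mem (Fin.succEmb n) h)
    simpa using (hout i hi').le
  · have h0 : ∀ i, v ((b i - 1) * (b i + 1)) = v (xQ - x) := by simpa using hsq
    intro i j
    refine Fin.cases ?_ (fun i => ?_) i <;> refine Fin.cases ?_ (fun j => ?_) j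
    · simp
    · intro _
      rw [← h0 j, ← v.map_neg]
      congr 1
      simp only [Fin.cons_zero, Fin.cons_succ]
      ring
    · intro _
      simpa using hsq i
    · intro hij
      have hij' : i ≠ j := by rintro rfl; exact hij rfl
      simp only [Fin.cons_succ]
      rw [sq_sub_sq_eq hx hb]
      simp [haa i j hij', hxa]

end SqrtChoice

end Local

/-! ### The representative of the class -/

section Representative

namespace BinaryForm

variable {L : Type*} [Field L] {r : ℕ}

/-- The form `∏ lⱼ ((c + 2 - γⱼ) X - τ (c - γⱼ) Z)`. It is obtained from `∏ (X - γⱼ Z)` by a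
substitution and a scaling, and has the roots `τ (c - γⱼ) / (c + 2 - γⱼ)`. -/
def blowUp (c τ : L) (l γ : Fin r → L) : BinaryForm L r :=
  ofLinearFactors (fun j => l j * (c + 2 - γ j)) (fun j => l j * (τ * (c - γ j)))

theorem cls_blowUp {c τ : L} {l γ : Fin r → L} (h2 : (2 : L) ≠ 0) (hτ : τ ≠ 0)
    (hl : ∀ j, l j ≠ 0) : (blowUp c τ l γ).cls = (ofLinearFactors (fun _ => 1) γ).cls := by
  have hdet : (!![c + 2, -(τ * c); 1, -τ]).det ≠ 0 := by
    rw [Matrix.det_fin_two_of, show (c + 2) * -τ - -(τ * c) * 1 = -(2 * τ) by ring]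
    exact neg_ne_zero.mpr (mul_ne_zero h2 hτ)
  have hU : ∀ i j, Matrix.GeneralLinearGroup.mkOfDetNeZero _ hdet i j =
      !![c + 2, -(τ * c); 1, -τ] i j := fun _ _ => rfl
  rw [← cls_ofLinearFactors_eq (Matrix.GeneralLinearGroup.mkOfDetNeZero _ hdet) l hl γ, blowUp]
  congr 2
  · funext j
    rw [hU, hU]
    simp
  · funext j
    rw [hU, hU]
    simp only [Matrix.of_apply, Matrix.cons_val', Matrix.cons_val_one, Matrix.cons_val_fin_one,
      Matrix.cons_val_zero]
    ring

theorem valuation_blowUp_det {Γ : Type*} [LinearOrderedCommGroupWithZero Γ] {v : Valuation L Γ}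
    (h2 : v 2 = 1) (c τ : L) (l γ : Fin r → L) (i j : Fin r) :
    v (l i * (c + 2 - γ i) * (l j * (τ * (c - γ j))) -
      l j * (c + 2 - γ j) * (l i * (τ * (c - γ i)))) =
      v (l i) * v (l j) * (v τ * v (γ i - γ j)) := by
  rw [show l i * (c + 2 - γ i) * (l j * (τ * (c - γ j))) -
      l j * (c + 2 - γ j) * (l i * (τ * (c - γ i))) = 2 * (l i * l j * (τ * (γ i - γ j))) by ring]
  simp [h2]

variable [NumberField L] {p : HeightOneSpectrum (𝓞 L)} {c τ : L} {l γ : Fin r → L}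

theorem goodAt_blowUp_of_unitDeterminants (hr : 2 ≤ r) (h2 : p.valuation L 2 = 1)
    (hc : ∀ j, c + 2 - γ j ≠ 0) (hl : ∀ j, l j ≠ 0)
    (hlc : ∀ j, p.valuation L (l j) * content (p.valuation L) c τ (γ j) = 1)
    (H : UnitDeterminants (p.valuation L) c τ γ) : (blowUp c τ l γ).GoodAt p := by
  intro hlt
  refine (hlt.ne ?_).elim
  rw [blowUp, valuation_disc_ofLinearFactors _ hr fun j => mul_ne_zero (hl j) (hc j)]
  refine Finset.prod_eq_one fun j _ => Finset.prod_eq_one fun i hi => ?_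
  rw [valuation_blowUp_det h2, H i j (Finset.ne_of_mem_erase hi), mul_mul_mul_comm, hlc, hlc,
    mul_one]

/-- With `|τ| = ε` the roots in the cluster `N` at `-1` get the absolute value `ε²` and mutual
determinants `ε²`, and all other determinants become units. -/
theorem goodAt_blowUp_of_twoClusters (hr : 2 ≤ r) (h2 : p.valuation L 2 = 1)
    (hc : ∀ j, c + 2 - γ j ≠ 0) (hl : ∀ j, l j ≠ 0)
    (hlc : ∀ j, p.valuation L (l j) * content (p.valuation L) c τ (γ j) = 1) (hτ0 : τ ≠ 0)
    {N : Finset (Fin r)} (H : TwoClusters (p.valuation L) (p.valuation L τ) γ N)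
    (hc1 : p.valuation L (c + 1) < p.valuation L τ)
    (hodd : Odd N.card) (hN : N.card + 3 ≤ 2 * ((r + 1) / 2)) : (blowUp c τ l γ).GoodAt p := by
  classical
  intro hlt
  set v := p.valuation L
  set ε := v τ
  have hε0 : ε ≠ 0 := (Valuation.ne_zero_iff _).mpr hτ0
  obtain ⟨m, hm⟩ : ∃ m : ℕ, ε = WithZero.exp (-(m : ℤ)) := by
    refine ⟨(-WithZero.log ε).toNat, ?_⟩
    have hlog : WithZero.log ε ≤ 0 := by
      rw [← WithZero.exp_le_exp, WithZero.exp_log hε0, WithZero.exp_zero]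
      exact H.lt_one.le
    rw [Int.toNat_of_nonneg (by omega), neg_neg, WithZero.exp_log hε0]
  have hm0 : 0 < m := by
    rcases Nat.eq_zero_or_pos m with h | h
    · rw [h] at hm
      exact (H.lt_one.ne (by simpa using hm)).elim
    · exact h
  have hlin : ∀ j ∈ N, v (l j) = 1 := fun j hj => by
    have := hlc j
    rwa [H.content_of_mem h2 hc1 (mul_le_one' H.lt_one.le H.lt_one.le) hj, mul_one] at this
  have hlout : ∀ j ∉ N, v (l j) * ε = 1 := fun j hj => by
    have := hlc j
    rwa [H.content_of_notMem h2 hc1 le_rfl hj] at this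
  have hdet : ∀ j, ∀ i ∈ Finset.univ.erase j, v (l i * (c + 2 - γ i) * (l j * (τ * (c - γ j))) -
      l j * (c + 2 - γ j) * (l i * (τ * (c - γ i)))) =
      if j ∈ N then (if i ∈ N then ε ^ 2 else 1) else 1 := by
    intro j i hij
    have hij' := Finset.ne_of_mem_erase hij
    rw [valuation_blowUp_det h2]
    by_cases hj : j ∈ N <;> by_cases hi : i ∈ N
    · rw [if_pos hj, if_pos hi, hlin i hi, hlin j hj, H.valuation_sub_of_mem h2 hij' hi hj]
      rw [one_mul, one_mul, sq]
    · rw [if_pos hj, if_neg hi, hlin j hj, v.map_sub_swap,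
        H.valuation_sub_of_mem_of_notMem h2 hj hi, mul_one, mul_one, hlout i hi]
    · rw [if_neg hj, hlin i hi, H.valuation_sub_of_mem_of_notMem h2 hi hj, mul_one, one_mul,
        hlout j hj]
    · rw [if_neg hj, H.valuation_sub_of_notMem h2 hij' hi hj, mul_mul_mul_comm, hlout i hi,
        hlout j hj, mul_one]
  have hdisc : v (blowUp c τ l γ).disc = ε ^ (2 * (N.card * (N.card - 1))) := by
    rw [blowUp, valuation_disc_ofLinearFactors _ hr fun j => mul_ne_zero (hl j) (hc j)]
    rw [Finset.prod_congr rfl fun j _ => Finset.prod_congr rfl (hdet j)]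
    have h1 : ∀ j, (∏ i ∈ Finset.univ.erase j,
        if j ∈ N then (if i ∈ N then ε ^ 2 else 1) else 1) =
        if j ∈ N then (ε ^ 2) ^ (N.card - 1) else 1 := by
      intro j
      split_ifs with hj
      · rw [Finset.prod_ite_mem, Finset.erase_inter, Finset.univ_inter, Finset.prod_const,
          Finset.card_erase_of_mem hj]
      · simp
    rw [Finset.prod_congr rfl fun j _ => h1 j, Finset.prod_ite_mem, Finset.univ_inter,
      Finset.prod_const, ← pow_mul, ← pow_mul]
    congr 1
    ring
  -- a cluster of one element does not contribute to the discriminant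
  have hn3 : 3 ≤ N.card := by
    by_contra! h
    have h1 : N.card = 1 := by
      obtain ⟨q, hq⟩ := hodd
      omega
    rw [hdisc, h1] at hlt
    simp at hlt
  refine ⟨m, N.card, hm0, hodd, hn3, hN, ?_, ?_⟩
  · change v _ = _
    rw [hdisc, hm, ← WithZero.exp_nsmul]
    congr 1
    rw [nsmul_eq_mul]
    push_cast [Nat.cast_sub (show 1 ≤ N.card by omega)]
    ring
  · refine ⟨N.image fun j => l j * (τ * (c - γ j)) / (l j * (c + 2 - γ j)), ?_, ?_⟩
    · refine Finset.card_image_of_injOn fun i hi j hj hij => ?_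
      by_contra hne
      have h1 := H.valuation_sub_of_mem h2 hne hi hj
      have h3 : v (l i * (c + 2 - γ i) * (l j * (τ * (c - γ j))) -
          l j * (c + 2 - γ j) * (l i * (τ * (c - γ i)))) = 0 := by
        rw [Valuation.zero_iff]
        rw [div_eq_div_iff (mul_ne_zero (hl i) (hc i)) (mul_ne_zero (hl j) (hc j))] at hij
        linear_combination -hij
      rw [valuation_blowUp_det h2, hlin i hi, hlin j hj, h1] at h3
      rw [one_mul, one_mul] at h3
      exact mul_ne_zero hε0 hε0 h3
    · intro u hu
      obtain ⟨j, hj, rfl⟩ := Finset.mem_image.mp hu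
      refine ⟨isRoot_dehomog_ofLinearFactors j (mul_ne_zero (hl j) (hc j)), ?_⟩
      change v _ = _
      rw [map_div₀, v.map_mul (l j) (c + 2 - γ j), v.map_mul (l j), hlin j hj,
        H.valuation_left_of_mem h2 hc1 hj,
        H.valuation_right_of_mem hc1 hj, show v τ = ε from rfl, hm, one_mul, one_mul, div_one,
        ← WithZero.exp_add]
      congr 1
      ring

end BinaryForm

open BinaryForm

variable {L : Type*} [Field L] [NumberField L]

/-- At the primes outside `T` the valuations of an element can be prescribed: as those of given
elements at finitely many primes, and as `1` at the other ones. -/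
def RealizesValuations (T : Finset (HeightOneSpectrum (𝓞 L))) : Prop :=
  ∀ (A : Finset (HeightOneSpectrum (𝓞 L))) (z : HeightOneSpectrum (𝓞 L) → L),
    (∀ p ∈ A, z p ≠ 0) → ∃ t : L, t ≠ 0 ∧
      (∀ p ∉ T, p ∈ A → p.valuation L t = p.valuation L (z p)) ∧
      ∀ p ∉ T, p ∉ A → p.valuation L t = 1

/-- A linear form can be scaled to be primitive outside `T`. -/
theorem RealizesValuations.exists_primitive {T : Finset (HeightOneSpectrum (𝓞 L))}
    (hT : RealizesValuations T) {a : L} (ha : a ≠ 0) (b : L) :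
    ∃ l : L, l ≠ 0 ∧ ∀ p ∉ T, p.valuation L l * max (p.valuation L a) (p.valuation L b) = 1 := by
  classical
  have h1 := finite_setOf_valuation_ne_one ha
  have h2 := HeightOneSpectrum.Support.finite (𝓞 L) b
  have hz0 : ∀ p : HeightOneSpectrum (𝓞 L), p.valuation L a < p.valuation L b → b ≠ 0 := by
    rintro p h rfl
    simp at h
  obtain ⟨l, hl0, hl1, hl2⟩ := hT (h1.toFinset ∪ h2.toFinset)
    (fun p => if p.valuation L a < p.valuation L b then b⁻¹ else a⁻¹) (fun p _ => by
      split_ifs with h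
      · exact inv_ne_zero (hz0 p h)
      · exact inv_ne_zero ha)
  refine ⟨l, hl0, fun p hp => ?_⟩
  by_cases hpA : p ∈ h1.toFinset ∪ h2.toFinset
  · rw [hl1 p hp hpA]
    split_ifs with h
    · rw [max_eq_right h.le, ← map_mul, inv_mul_cancel₀ (hz0 p h), map_one]
    · rw [max_eq_left (not_lt.mp h), ← map_mul, inv_mul_cancel₀ ha, map_one]
  · rw [hl2 p hp hpA, one_mul]
    simp only [Finset.mem_union, Set.Finite.mem_toFinset, not_or] at hpA
    have e1 : p.valuation L a = 1 := by simpa using hpA.1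
    have e2 : p.valuation L b ≤ 1 := not_lt.mp hpA.2
    rw [e1, max_eq_left e2]

/-- The form `(X - Z) ∏ (X - βᵢ Z)` belongs to `B'`, for a point `P` which does not reduce to `Q`
at any prime outside `T`. -/
theorem cls_ofRoots_mem_BPrime {g : ℕ} {T : Finset (HeightOneSpectrum (𝓞 L))}
    (hT : RealizesValuations T) {a b : Fin (2 * g + 1) → L} {x y xQ yQ : L}
    (h2 : ∀ p ∉ T, p.valuation L 2 = 1) (ha : ∀ p ∉ T, ∀ i, p.valuation L (a i) ≤ 1)
    (haa : ∀ p ∉ T, ∀ i j, i ≠ j → p.valuation L (a i - a j) = 1)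
    (hxQ : ∀ p ∉ T, p.valuation L xQ ≤ 1)
    (hxQa : ∀ p ∉ T, ∀ i, xQ ≠ a i → p.valuation L (xQ - a i) = 1)
    (hyQ : ∀ p ∉ T, yQ ≠ 0 → p.valuation L yQ = 1)
    (hne : ∀ p ∉ T, p.valuation L (x - xQ) < 1 → ¬ p.valuation L (y - yQ) < 1)
    (hy : y ^ 2 = ∏ i, (x - a i)) (hyQ2 : yQ ^ 2 = ∏ i, (xQ - a i)) (hy0 : y ≠ 0) (hxx : xQ ≠ x)
    (hb : ∀ i, b i ^ 2 = (xQ - a i) / (x - a i)) (hprod : ∏ i, b i = yQ / y) :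
    (ofRoots b).cls ∈ BPrime (2 * g + 2) L T := by
  classical
  have hx : ∀ i, x ≠ a i := fun i h => hy0 (by
    rw [Finset.prod_eq_zero (Finset.mem_univ i) (sub_eq_zero.mpr h)] at hy
    simpa using hy)
  have hxx' : xQ - x ≠ 0 := sub_ne_zero.mpr hxx
  let γ : Fin (2 * g + 1 + 1) → L := Fin.cons 1 b
  have hA1 := HeightOneSpectrum.Support.finite (𝓞 L) x
  have hA2 := finite_setOf_valuation_ne_one hxx'
  set A := hA1.toFinset ∪ hA2.toFinset
  have hx0 : ∀ p : HeightOneSpectrum (𝓞 L), 1 < p.valuation L x → x ≠ 0 := by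
    rintro p h rfl
    simp at h
  -- `τ` has the valuation of `y / xᵍ` where `P` reduces to infinity, and that of `(xQ - x)^±1`
  -- where `P` reduces to the conjugate of `Q`.
  obtain ⟨τ, hτ0, hτ1, hτ2⟩ := hT A
    (fun p => if 1 < p.valuation L x then y / x ^ g
      else if p.valuation L (xQ - x) < 1 then
        (if ∀ i, p.valuation L (b i + 1) < 1 then (xQ - x)⁻¹ else xQ - x)
      else 1)
    (fun p _ => by
      split_ifs with h1
      · exact div_ne_zero hy0 (pow_ne_zero _ (hx0 p h1))
      · exact inv_ne_zero hxx'
      · exact hxx'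
      · exact one_ne_zero)
  -- The finitely many values to be avoided would send a root to infinity.
  obtain ⟨c, hcF, hc⟩ := exists_integer_valuation_sub_lt A
    (fun p => if 1 < p.valuation L x then 0 else -1)
    (fun p => if 1 < p.valuation L x then x ^ g / y else xQ - x)
    (fun p _ => by
      split_ifs with h1
      · exact div_ne_zero (pow_ne_zero _ (hx0 p h1)) hy0
      · exact hxx')
    (Finset.univ.image fun j => γ j - 2)
  set c' : L := algebraMap (𝓞 L) L c
  have hcint : ∀ p : HeightOneSpectrum (𝓞 L), p.valuation L c' ≤ 1 := fun p =>
    p.valuation_le_one c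
  have hcne : ∀ j, c' + 2 - γ j ≠ 0 := by
    intro j h
    refine hcF (Finset.mem_image.mpr ⟨j, Finset.mem_univ j, ?_⟩)
    linear_combination -h
  choose l hl0 hl using fun j => hT.exists_primitive (hcne j) (τ * (c' - γ j))
  have hlc : ∀ p ∉ T, ∀ j, p.valuation L (l j) * content (p.valuation L) c' τ (γ j) = 1 :=
    fun p hp j => hl j p hp
  refine ⟨blowUp c' τ l γ, ?_, ?_, ?_⟩
  · rw [cls_blowUp two_ne_zero hτ0 hl0, ofRoots_eq_ofLinearFactors]
  · refine isSIntegral_ofLinearFactors (fun p hp j => ?_) (fun p hp j => ?_)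
    · rw [map_mul, ← hl j p hp]
      gcongr
      exact le_max_left _ _
    · rw [map_mul, ← hl j p hp]
      gcongr
      exact le_max_right _ _
  intro p hp
  set v := p.valuation L
  rcases lt_or_ge 1 (v x) with hvx | hvx
  · -- `P` reduces to the point at infinity
    have hpA : p ∈ A := Finset.mem_union_left _ (hA1.mem_toFinset.mpr hvx)
    have e1 : v τ = v (y / x ^ g) := by rw [hτ1 p hp hpA, if_pos hvx]
    have e2 : v c' < v (x ^ g / y) := by
      have := hc p hpA
      rwa [if_pos hvx, if_pos hvx, map_zero, sub_zero] at this
    have hvx0 : v x ≠ 0 := (zero_lt_one.trans hvx).ne'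
    have e3 : v y ^ 2 = v x ^ (2 * g + 1) := by
      rw [← map_pow, hy, map_prod, Finset.prod_congr rfl fun i _ =>
        v.map_sub_eq_of_lt_left ((ha p hp i).trans_lt hvx)]
      simp
    refine goodAt_blowUp_of_unitDeterminants (by omega) (h2 p hp) hcne hl0 (hlc p hp)
      (unitDeterminants_of_one_lt (h2 p hp) (ha p hp) (haa p hp) (hxQ p hp) hx hb hvx ?_ ?_)
    · rw [e1, map_div₀, map_pow, div_pow, e3]
      have hv2 : v x ^ (2 * g + 1) = (v x ^ g) ^ 2 * v x := by
        rw [pow_succ, mul_comm 2 g, pow_mul]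
      rw [hv2, mul_div_cancel_left₀ _ (pow_ne_zero 2 (pow_ne_zero g hvx0))]
    · rw [map_mul, e1]
      have hle : v (y / x ^ g) * v c' ≤ v (y / x ^ g) * v (x ^ g / y) := by gcongr
      refine hle.trans ?_
      rw [← map_mul, div_mul_div_cancel₀ (pow_ne_zero _ (hx0 p hvx)), div_self hy0, map_one]
  rcases lt_or_ge (v (xQ - x)) 1 with hlt | hge
  · have hpA : p ∈ A := Finset.mem_union_right _ (hA2.mem_toFinset.mpr hlt.ne)
    have e1 : v τ = v (if ∀ i, v (b i + 1) < 1 then (xQ - x)⁻¹ else xQ - x) := by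
      rw [hτ1 p hp hpA, if_neg hvx.not_gt, if_pos hlt]
    have e2 : v (c' + 1) < v (xQ - x) := by
      have := hc p hpA
      rwa [if_neg hvx.not_gt, if_neg hvx.not_gt, map_neg, map_one, sub_neg_eq_add] at this
    -- the reduction of `P` is the conjugate of `Q`, and different from `Q`
    have hyle : v y ≤ 1 := by
      apply le_one_of_sq_le_one
      rw [← map_pow, hy, map_prod]
      exact Finset.prod_le_one' fun i _ => v.map_sub_le hvx (ha p hp i)
    have hyQle : v yQ ≤ 1 := by
      by_cases h : yQ = 0
      · simp [h]
      · exact (hyQ p hp h).le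
    have e3 : v (y - yQ) = 1 := le_antisymm (v.map_sub_le hyle hyQle)
      (not_lt.mp (hne p hp (by rwa [v.map_sub_swap])))
    have e4 : v (y + yQ) < 1 := by
      have h := valuation_prod_sub_prod_lt_one (v := v) Finset.univ
        (b := fun i => x - a i) (c := fun i => xQ - a i)
        (fun i => v.map_sub_le hvx (ha p hp i)) (fun i => v.map_sub_le (hxQ p hp) (ha p hp i))
        (fun i => by rwa [sub_sub_sub_cancel_right, v.map_sub_swap])
      rwa [← hy, ← hyQ2, sq_sub_sq, map_mul, e3, mul_one] at h
    have hyQ0 : yQ ≠ 0 := by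
      rintro rfl
      rw [sub_zero] at e3
      rw [add_zero, e3] at e4
      exact lt_irrefl _ e4
    have e5 : v y = 1 := by
      rw [show y = (y + yQ) - yQ by ring, v.map_sub_eq_of_lt_right, hyQ p hp hyQ0]
      rwa [hyQ p hp hyQ0]
    have e6 : ∀ i, v (xQ - a i) = 1 := fun i => hxQa p hp i fun h => hyQ0 (by
      rw [Finset.prod_eq_zero (Finset.mem_univ i) (sub_eq_zero.mpr h)] at hyQ2
      simpa using hyQ2)
    have e7 : v (∏ i, b i + 1) < 1 := by
      rw [hprod, show yQ / y + 1 = (y + yQ) / y by field_simp; ring, map_div₀, e5, div_one]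
      exact e4
    obtain ⟨N, hodd, H⟩ := exists_twoClusters (h2 p hp) (haa p hp) e6 hx hb hlt e7
    by_cases hall : ∀ i, v (b i + 1) < 1
    · -- only `γ₀ = 1` is not close to `-1`
      rw [if_pos hall] at e1
      refine goodAt_blowUp_of_unitDeterminants (by omega) (h2 p hp) hcne hl0 (hlc p hp)
        (H.unitDeterminants (h2 p hp) e2 ?_ ?_)
      · rw [e1, ← map_mul, inv_mul_cancel₀ hxx', map_one]
      · have h0 : ∀ i : Fin (2 * g + 1 + 1), i ∉ N.map (Fin.succEmb _) → i = 0 := by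
          intro i
          refine Fin.cases (fun _ => rfl) (fun i hi => ?_) i
          have h1 : v (b i - 1) < 1 := (H.sub_one _ hi).trans_lt hlt
          have h3 := v.map_sub_lt (hall i) h1
          rw [show b i + 1 - (b i - 1) = 2 by ring, h2 p hp] at h3
          exact (lt_irrefl _ h3).elim
        intro i j hi hj
        rw [h0 i hi, h0 j hj]
    · -- an odd number below `2g + 1` is at most `2g - 1`
      rw [if_neg hall] at e1
      rw [← e1] at H e2
      refine goodAt_blowUp_of_twoClusters (by omega) (h2 p hp) hcne hl0 (hlc p hp) hτ0 H e2
        (by rwa [Finset.card_map]) ?_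
      rw [Finset.card_map]
      have hlt' : N.card < 2 * g + 1 := by
        push Not at hall
        obtain ⟨i, hi⟩ := hall
        have hiN : i ∉ N := fun h => by
          have h3 := H.add_one _ (Finset.mem_map_of_mem (Fin.succEmb _) h)
          simp only [Fin.coe_succEmb, Fin.cons_succ] at h3
          exact (H.lt_one.trans_le (hi.trans_eq h3)).false
        simpa using Finset.card_lt_univ_of_notMem hiN
      obtain ⟨q, hq⟩ := hodd
      omega
  · -- the reductions of `P` and `Q` have different `x`-coordinates
    have hvτ : v τ = 1 := by
      by_cases hpA : p ∈ A
      · rw [hτ1 p hp hpA, if_neg hvx.not_gt, if_neg hge.not_gt, map_one]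
      · exact hτ2 p hp hpA
    exact goodAt_blowUp_of_unitDeterminants (by omega) (h2 p hp) hcne hl0 (hlc p hp)
      (unitDeterminants_of_valuation_sub_eq_one (h2 p hp) (ha p hp) (haa p hp) hx hb hvx
        (le_antisymm (v.map_sub_le (hxQ p hp) hvx) hge) hvτ (hcint p))

end Representative

/-! ### Points on the curve and the field of definition of the square roots -/

section Main

section RootPoly

variable {k : Type*} [Field k] {n : ℕ} (α : Fin n → k)

theorem natDegree_rootPoly : (rootPoly α).natDegree = n := by
  rw [rootPoly, natDegree_prod_of_monic _ _ fun j _ => monic_X_sub_C _]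
  simp

theorem squarefree_rootPoly (hα : Function.Injective α) : Squarefree (rootPoly α) :=
  (separable_prod_X_sub_C_iff.mpr hα).squarefree

variable {α} {Ω : Type*} [Field Ω] [Algebra k Ω]

theorem AffinePoint.y_sq_eq (P : AffinePoint (rootPoly α) Ω) :
    P.y ^ 2 = ∏ i, (P.x - algebraMap k Ω (α i)) := by
  rw [P.equation]
  simp [rootPoly, map_prod]

end RootPoly

/-- Points with equal `x`-coordinates are equal or conjugate. -/
theorem AffinePoint.x_ne_of_notMem_exceptionalSet {K Ω : Type*} [Field K] [Field Ω] [Algebra K Ω]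
    {h : K[X]} {P Q : AffinePoint h Ω} (hP : P ∉ exceptionalSet Q) : Q.x ≠ P.x := by
  intro hx
  have hy : P.y ^ 2 = Q.y ^ 2 := by rw [P.equation, Q.equation, hx]
  rcases sq_eq_sq_iff_eq_or_eq_neg.mp hy with h | h
  · exact hP (Or.inr (Or.inl (AffinePoint.ext hx.symm h)))
  · exact hP (Or.inr (Or.inr (AffinePoint.ext hx.symm h)))

/-- Away from finitely many primes the valuations of `x_P - αᵢ` are even, as the product of these
factors is a square and the factors are nearly coprime. -/
theorem exists_finset_valuation_sub_eq_sq {k : Type*} [Field k] [NumberField k] {g : ℕ}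
    {α : Fin (2 * g + 1) → k} (hα : Function.Injective α) :
    ∃ S : Finset (HeightOneSpectrum (𝓞 k)), ∀ P : AffinePoint (rootPoly α) k, ∀ i, ∀ p ∉ S,
      ∃ z : k, p.valuation k (P.x - α i) = p.valuation k z ^ 2 := by
  classical
  obtain ⟨S, hS⟩ := exists_finset_valuation_eq_one
    (Finset.univ.image α ∪ Finset.univ.image fun ij : Fin (2 * g + 1) × Fin (2 * g + 1) =>
      α ij.1 - α ij.2)
  refine ⟨S, fun P i p hp => ?_⟩
  have hint : ∀ j, p.valuation k (α j) ≤ 1 := by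
    intro j
    by_cases h : α j = 0
    · simp [h]
    · exact (hS p hp _ (by simp) h).le
  have hdiff : ∀ j, j ≠ i → p.valuation k (α i - α j) = 1 := fun j hj =>
    hS p hp _ (Finset.mem_union_right _ (Finset.mem_image.mpr ⟨(i, j), Finset.mem_univ _, rfl⟩))
      (sub_ne_zero.mpr fun h => hj (hα h).symm)
  have hy : p.valuation k P.y ^ 2 = ∏ j, p.valuation k (P.x - α j) := by
    rw [← map_pow, P.y_sq_eq, map_prod]
    rfl
  rcases lt_or_ge 1 (p.valuation k P.x) with hx | hx
  · have hxa : ∀ j, p.valuation k (P.x - α j) = p.valuation k P.x := fun j =>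
      Valuation.map_sub_eq_of_lt_left _ ((hint j).trans_lt hx)
    have hx0 : p.valuation k P.x ≠ 0 := (zero_lt_one.trans hx).ne'
    refine ⟨P.y / P.x ^ g, ?_⟩
    rw [hxa, map_div₀, map_pow, div_pow, hy, Finset.prod_congr rfl fun j _ => hxa j,
      Finset.prod_const, Finset.card_univ, Fintype.card_fin, pow_succ, pow_mul',
      mul_div_cancel_left₀ _ (pow_ne_zero 2 (pow_ne_zero g hx0))]
  · rcases lt_or_ge (p.valuation k (P.x - α i)) 1 with hlt | hge
    · refine ⟨P.y, ?_⟩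
      rw [hy, Finset.prod_eq_single i]
      · intro j _ hj
        rw [show P.x - α j = (P.x - α i) + (α i - α j) by ring,
          Valuation.map_add_eq_of_lt_right _ (by rwa [hdiff j hj]), hdiff j hj]
      · simp
    · refine ⟨1, ?_⟩
      rw [map_one, one_pow]
      exact le_antisymm (Valuation.map_sub_le _ hx (hint i)) hge

/-- For a point `P` outside the exceptional set the square roots `βᵢ` can be chosen with
`∏ βᵢ = y_Q / y_P`. -/
theorem exists_isSqrtChoice {k : Type*} [Field k] {n : ℕ} {α : Fin (n + 1) → k}
    {Ω : Type*} [Field Ω] [Algebra k Ω] [IsAlgClosed Ω] (P Q : AffinePoint (rootPoly α) Ω) :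
    ∃ β : Fin (n + 1) → Ω, IsSqrtChoice α P Q β := by
  choose β hβ using fun i => IsAlgClosed.exists_pow_nat_eq
    ((Q.x - algebraMap k Ω (α i)) / (P.x - algebraMap k Ω (α i))) two_pos
  have hsq : (∏ i, β i) ^ 2 = (Q.y / P.y) ^ 2 := by
    rw [div_pow, P.y_sq_eq, Q.y_sq_eq, ← Finset.prod_pow, ← Finset.prod_div_distrib]
    exact Finset.prod_congr rfl fun i _ => hβ i
  rcases sq_eq_sq_iff_eq_or_eq_neg.mp hsq with h | h
  · exact ⟨β, hβ, h⟩
  · refine ⟨Fin.cons (-β 0) fun i => β i.succ, fun i => ?_, ?_⟩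
    · refine Fin.cases ?_ (fun i => ?_) i
      · rw [Fin.cons_zero, neg_sq, hβ]
      · rw [Fin.cons_succ, hβ]
    · rw [Fin.prod_univ_succ] at h ⊢
      simp only [Fin.cons_zero, Fin.cons_succ]
      rw [neg_mul, h, neg_neg]

/-- Finitely many constants detect the primes of an extension above a finite set of primes. -/
theorem exists_finset_valuation_algebraMap_le_one {k L : Type*} [Field k] [NumberField k] [Field L]
    [NumberField L] [Algebra k L] (S : Finset (HeightOneSpectrum (𝓞 k))) :
    ∃ W : Finset L, ∀ p : HeightOneSpectrum (𝓞 L), (∀ w ∈ W, w ≠ 0 → p.valuation L w = 1) →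
      ∀ c ∈ (S : Set (HeightOneSpectrum (𝓞 k))).integer k,
        p.valuation L (algebraMap k L c) ≤ 1 := by
  classical
  choose z hz hz0 using fun q : HeightOneSpectrum (𝓞 k) =>
    Submodule.exists_mem_ne_zero_of_ne_bot q.ne_bot
  refine ⟨S.image fun q => algebraMap (𝓞 L) L (algebraMap (𝓞 k) (𝓞 L) (z q)),
    fun p hp c hc => ?_⟩
  let q := HeightOneSpectrum.under (𝓞 k) p
  have : p.asIdeal.LiesOver q.asIdeal := ⟨rfl⟩
  have hq : q ∉ S := by
    intro hqS
    have h1 := hp _ (Finset.mem_image_of_mem _ hqS) (by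
      rw [ne_eq, map_eq_zero_iff _ (FaithfulSMul.algebraMap_injective (𝓞 L) L),
        map_eq_zero_iff _ (FaithfulSMul.algebraMap_injective (𝓞 k) (𝓞 L))]
      exact hz0 q)
    have h2 : algebraMap (𝓞 k) (𝓞 L) (z q) ∈ p.asIdeal := hz q
    rw [← HeightOneSpectrum.valuation_lt_one_iff_mem (K := L)] at h2
    exact h2.ne h1
  rw [← HeightOneSpectrum.valuation_liesOver L q p c]
  exact pow_le_one' (hc q hq) _

end Main

end HyperellipticForms

end

open HyperellipticForms

theorem mainTheorem4 {k : Type*} [Field k] [NumberField k] (g : ℕ) (hg : 1 ≤ g)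
    (α : Fin (2 * g + 1) → k) (hα : Function.Injective α)
    (f : HyperellipticForms.RatFun (HyperellipticForms.rootPoly α))
    (hf : f ∉ Set.range (algebraMap k
      (HyperellipticForms.RatFun (HyperellipticForms.rootPoly α))))
    (S : Finset (HeightOneSpectrum (𝓞 k)))
    (Q : HyperellipticForms.AffinePoint (HyperellipticForms.rootPoly α) (AlgebraicClosure k))
    (hQ : Q.IsPole f) :
    ∃ (L : IntermediateField k (AlgebraicClosure k)) (_ : NumberField L)
      (T : Finset (HeightOneSpectrum (𝓞 L))),
      ∀ P ∈ HyperellipticForms.integralPoints f S,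
        P.baseChange (AlgebraicClosure k) ∉ HyperellipticForms.exceptionalSet Q →
          (∃ β : Fin (2 * g + 1) → AlgebraicClosure k,
            HyperellipticForms.IsSqrtChoice α (P.baseChange (AlgebraicClosure k)) Q β) ∧
          ∀ β : Fin (2 * g + 1) → AlgebraicClosure k,
            HyperellipticForms.IsSqrtChoice α (P.baseChange (AlgebraicClosure k)) Q β →
              ∃ b : Fin (2 * g + 1) → L,
                (∀ i, algebraMap L (AlgebraicClosure k) (b i) = β i) ∧
                (HyperellipticForms.BinaryForm.ofRoots b).cls ∈
                  HyperellipticForms.BinaryForm.BPrime (2 * g + 2) L T := by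
  classical
  obtain ⟨S', hS'⟩ := exists_finset_valuation_sub_eq_sq hα
  obtain ⟨E, hE⟩ := exists_finset_eq_mul_sq S'
  let Ω := AlgebraicClosure k
  choose r hr using fun u : Ω => IsAlgClosed.exists_pow_nat_eq u two_pos
  let G : Finset Ω := {Q.x, Q.y} ∪ (Finset.univ.image fun i => r (Q.x - algebraMap k Ω (α i))) ∪
    E.image fun e => r (algebraMap k Ω e)
  let L : IntermediateField k Ω := IntermediateField.adjoin k (G : Set Ω)
  have hGL : ∀ u ∈ G, u ∈ L := fun u hu => IntermediateField.subset_adjoin k _ hu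
  have hfd : FiniteDimensional k L :=
    IntermediateField.finiteDimensional_adjoin fun u _ => Algebra.IsIntegral.isIntegral u
  have hL : NumberField L := NumberField.of_module_finite k L
  -- the pole, as a point over `L`
  let xL : L := ⟨Q.x, hGL _ (by simp [G])⟩
  let yL : L := ⟨Q.y, hGL _ (by simp [G])⟩
  let QL : AffinePoint (rootPoly α) L := ⟨xL, yL,
    Subtype.ext (Q.equation.trans (aeval_algHom_apply L.val xL (rootPoly α)))⟩
  have hQL : QL.map L.val = Q := rfl
  obtain ⟨a, b, hab, ha, hb⟩ := hQ.exists_mul_eq (squarefree_rootPoly α hα)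
    (by rw [natDegree_rootPoly]; exact odd_two_mul_add_one g)
  rw [← hQL, AffinePoint.evalAt_map] at ha hb
  obtain ⟨W, hW⟩ := exists_finset_not_congr_pole (Γ := WithZero (Multiplicative ℤ)) QL hab
    (by simpa using ha) (by simpa using hb)
  obtain ⟨W', hW'⟩ := exists_finset_valuation_algebraMap_le_one (L := L) S
  let αL : Fin (2 * g + 1) → L := fun i => algebraMap k L (α i)
  obtain ⟨T₁, hT₁⟩ := exists_finset_valuation_eq_one (W ∪ W' ∪ {2, QL.x, QL.y} ∪
    Finset.univ.image αL ∪ (Finset.univ.image fun i => QL.x - αL i) ∪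
    Finset.univ.image fun ij : Fin (2 * g + 1) × Fin (2 * g + 1) => αL ij.1 - αL ij.2)
  obtain ⟨T₂, hT₂⟩ := exists_valuation_eq L
  refine ⟨L, hL, T₁ ∪ T₂, fun P hP hPQ => ⟨exists_isSqrtChoice _ _, fun β hβ => ?_⟩⟩
  have hT : RealizesValuations (T₁ ∪ T₂) := fun A z hz => by
    obtain ⟨t, h0, h1, h2⟩ := hT₂ A z hz
    exact ⟨t, h0, fun p hp => h1 p fun h => hp (Finset.mem_union_right _ h),
      fun p hp => h2 p fun h => hp (Finset.mem_union_right _ h)⟩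
  have hT₁' : ∀ p ∉ T₁ ∪ T₂, p ∉ T₁ := fun p hp h => hp (Finset.mem_union_left _ h)
  have hPy : P.y ≠ 0 := fun h => hPQ (Or.inl (by simp [AffinePoint.baseChange, h]))
  have hPα : ∀ i, P.x - α i ≠ 0 := fun i h => hPy (by
    have := P.y_sq_eq
    rw [Finset.prod_eq_zero (Finset.mem_univ i) (by simpa using h)] at this
    simpa using this)
  have hxne := AffinePoint.x_ne_of_notMem_exceptionalSet hPQ
  -- the `βᵢ` lie in `L`
  have hβL : ∀ i, β i ∈ L := by
    intro i
    obtain ⟨e, he, t, ht⟩ := hE (P.x - α i) (hPα i) fun p hp => hS' P i p hp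
    have he0 : e ≠ 0 := by rintro rfl; exact hPα i (by simpa using ht)
    have hre0 : r (algebraMap k Ω e) ≠ 0 := by
      intro h
      have := hr (algebraMap k Ω e)
      rw [h, zero_pow two_ne_zero] at this
      exact he0 ((map_eq_zero _).mp this.symm)
    have hden : (P.baseChange Ω).x - algebraMap k Ω (α i) =
        (r (algebraMap k Ω e) * algebraMap k Ω t) ^ 2 := by
      rw [mul_pow, hr, ← map_pow, ← map_mul, ← ht, map_sub]
      rfl
    have hsq : β i ^ 2 = (r (Q.x - algebraMap k Ω (α i)) /
        (r (algebraMap k Ω e) * algebraMap k Ω t)) ^ 2 := by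
      rw [hβ.1 i, hden, div_pow, hr]
    have hmem : r (Q.x - algebraMap k Ω (α i)) / (r (algebraMap k Ω e) * algebraMap k Ω t) ∈ L := by
      refine div_mem (hGL _ ?_) (mul_mem (hGL _ ?_) (L.algebraMap_mem t))
      · simp [G]
      · exact Finset.mem_union_right _ (Finset.mem_image_of_mem _ he)
    rcases sq_eq_sq_iff_eq_or_eq_neg.mp hsq with h | h
    · rw [h]; exact hmem
    · rw [h]; exact neg_mem hmem
  refine ⟨fun i => ⟨β i, hβL i⟩, fun i => rfl, ?_⟩
  obtain ⟨c, hc, hcP⟩ := hP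
  refine cls_ofRoots_mem_BPrime hT (a := αL) (x := algebraMap k L P.x) (y := algebraMap k L P.y)
    (xQ := QL.x) (yQ := QL.y) ?_ ?_ ?_ ?_ ?_ ?_ ?_ ?_ QL.y_sq_eq ?_ ?_ ?_ ?_
  · exact fun p hp => hT₁ p (hT₁' p hp) 2 (by simp) two_ne_zero
  · intro p hp i
    by_cases h : αL i = 0
    · simp [h]
    · exact (hT₁ p (hT₁' p hp) _ (by simp) h).le
  · intro p hp i j hij
    refine hT₁ p (hT₁' p hp) _ (Finset.mem_union_right _
      (Finset.mem_image.mpr ⟨(i, j), Finset.mem_univ _, rfl⟩)) ?_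
    exact sub_ne_zero.mpr fun h => hij (hα ((algebraMap k L).injective h))
  · intro p hp
    by_cases h : QL.x = 0
    · simp [h]
    · exact (hT₁ p (hT₁' p hp) _ (by simp) h).le
  · intro p hp i hi
    exact hT₁ p (hT₁' p hp) _ (by simp) (sub_ne_zero.mpr hi)
  · exact fun p hp h => hT₁ p (hT₁' p hp) _ (by simp) h
  · intro p hp
    exact hW (p.valuation L) (fun w hw => hT₁ p (hT₁' p hp) w (by simp [hw])) P c hcP
      (hW' p (fun w hw => hT₁ p (hT₁' p hp) w (by simp [hw])) c hc)
  · rw [← map_pow, P.y_sq_eq, map_prod]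
    exact Finset.prod_congr rfl fun i _ => map_sub _ _ _
  · simpa using hPy
  · intro h
    exact hxne (congrArg L.val h)
  · intro i
    apply L.val.injective
    rw [map_pow, map_div₀, map_sub, map_sub]
    exact hβ.1 i
  · apply L.val.injective
    rw [map_prod, map_div₀]
    exact hβ.2
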